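/- Let $n\ge 2$ and let $P\subset\mathbb{H}^n$ be a compact convex right-angled polytope, i.e. a compact intersection of finitely many closed half-spaces, with non-empty interior, all of whose dihedral angles (between facets sharing a face of codimension two) equal $\pi/2$. Let $\Gamma=\langle r_F \mid r_F^2,\ [r_F,r_{F'}]\rangle$, where $F$ runs over the facets of $P$ and $(F,F')$ over the pairs of adjacent facets, act on $\mathbb{H}^n$ by letting $r_F$ act as the reflection in the hyperplane containing $F$; $P$ is regarded as the orbifold $\mathbb{H}^n/\Gamma$. Let $V$ be a finite-dimensional vector space over $\mathbb{F}_2$. A $V$-colouring $\lambda$ of $P$ assigns to each facet $F$ a vector $\lambda_F\in V$ such that at every vertex of $P$ the colours of the facets containing it are linearly independent. It induces a homomorphism $\lambda:\Gamma\to V$, $r_F\mapsto\lambda_F$, with kernel $\Gamma_\lambda$; put $M_\lambda=\mathbb{H}^n/\Gamma_\lambda$ with the quotient metric, and let the cover $M_\lambda\to P$ send the class of $x\in\mathbb{H}^n$ to the point of $P$ in the $\Gamma$-orbit of $x$. Let $\lambda$ be a $V$-colouring of $P$ and let $F$ be a facet of $P$, contained in the hyperplane $H\cong\mathbb{H}^{n-1}$.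 Then $F$ is a compact convex right-angled polytope in $H$. Assigning to each facet $F\cap G$ of $F$ (with $G\ne F$ a facet of $P$) the class of $\lambda_G$ gives a well-defined $V/\langle\lambda_F\rangle$-colouring $\mu$ of $F$. The quotients $M_\lambda$ and $M_\mu=H/(\Gamma_F)_\mu$ (where $\Gamma_F$ is the Coxeter group of $F$ and $(\Gamma_F)_\mu$ is the kernel of $\mu:\Gamma_F\to V/\langle\lambda_F\rangle$) are hyperbolic manifolds of dimensions $n$ and $n-1$, and the covers $M_\lambda\to P$ and $M_\mu\to F$ are well defined and continuous. The inclusion $H\subset\mathbb{H}^n$ induces an embedding $\iota: M_\mu\to M_\lambda$ of $M_\mu$ as a totally geodesic submanifold, and the cover $M_\lambda\to P$ restricts along $\iota$ to the cover $M_\mu\to F\subset P$. -/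

import Mathlib

noncomputable section

/-! ### Hyperbolic space (hyperboloid model) -/

/-- Minkowski space `ℝ^{1,n}`: pairs of a time coordinate and a space vector. -/
abbrev Minkowski (n : ℕ) : Type := ℝ × EuclideanSpace ℝ (Fin n)

/-- The Lorentzian product `-x₀ y₀ + x₁ y₁ + ⋯ + xₙ yₙ`. -/
def lorentz {n : ℕ} (x y : Minkowski n) : ℝ := -(x.1 * y.1) + inner ℝ x.2 y.2

/-- Hyperbolic `n`-space: the upper sheet of the hyperboloid `⟨x, x⟩ = -1`. -/
@[ext]
structure HypSpace (n : ℕ) where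
  vec : Minkowski n
  lorentz_self : lorentz vec vec = -1
  time_pos : 0 < vec.1

/-- A unit space-like vector; it determines a hyperplane of `HypSpace n` with a chosen side. -/
@[ext]
structure UnitNormal (n : ℕ) where
  vec : Minkowski n
  lorentz_self : lorentz vec vec = 1

section lorentzFacts

variable {n : ℕ}

theorem lorentz_comm (x y : Minkowski n) : lorentz x y = lorentz y x := by
  simp only [lorentz, real_inner_comm, mul_comm]

theorem lorentz_add_left (x y z : Minkowski n) :
    lorentz (x + y) z = lorentz x z + lorentz y z := by
  simp only [lorentz, Prod.fst_add, Prod.snd_add, inner_add_left]; ring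

theorem lorentz_smul_left (a : ℝ) (x z : Minkowski n) :
    lorentz (a • x) z = a * lorentz x z := by
  simp only [lorentz, Prod.smul_fst, Prod.smul_snd, real_inner_smul_left, smul_eq_mul]; ring

theorem lorentz_sub_left (x y z : Minkowski n) :
    lorentz (x - y) z = lorentz x z - lorentz y z := by
  simp only [lorentz, Prod.fst_sub, Prod.snd_sub, inner_sub_left]; ring

theorem lorentz_add_right (x y z : Minkowski n) :
    lorentz x (y + z) = lorentz x y + lorentz x z := by
  rw [lorentz_comm, lorentz_add_left, lorentz_comm y, lorentz_comm z]

theorem lorentz_sub_right (x y z : Minkowski n) :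
    lorentz x (y - z) = lorentz x y - lorentz x z := by
  rw [lorentz_comm, lorentz_sub_left, lorentz_comm y, lorentz_comm z]

theorem lorentz_smul_right (a : ℝ) (x z : Minkowski n) :
    lorentz x (a • z) = a * lorentz x z := by
  rw [lorentz_comm, lorentz_smul_left, lorentz_comm]

theorem HypSpace.norm_lt (x : HypSpace n) : ‖x.vec.2‖ < x.vec.1 := by
  have h := x.lorentz_self
  rw [lorentz, real_inner_self_eq_norm_sq] at h
  nlinarith [norm_nonneg x.vec.2, x.time_pos]

/-- The form is positive semidefinite on the orthogonal complement of a point of `HypSpace n`. -/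
theorem HypSpace.lorentz_self_nonneg (y : HypSpace n) (w : Minkowski n)
    (hw : lorentz y.vec w = 0) : 0 ≤ lorentz w w := by
  have h1 := y.norm_lt
  have h2 := abs_real_inner_le_norm y.vec.2 w.2
  rw [lorentz] at hw
  rw [lorentz, real_inner_self_eq_norm_sq]
  have h3 : inner ℝ y.vec.2 w.2 = y.vec.1 * w.1 := by linarith
  rw [h3, abs_mul, abs_of_pos y.time_pos] at h2
  have h4 : y.vec.1 * |w.1| ≤ y.vec.1 * ‖w.2‖ :=
    h2.trans (mul_le_mul_of_nonneg_right h1.le (norm_nonneg _))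
  have h5 : |w.1| ≤ ‖w.2‖ := le_of_mul_le_mul_left h4 y.time_pos
  have h6 := sq_le_sq' (by linarith [abs_nonneg w.1, norm_nonneg w.2]) h5
  rw [sq_abs] at h6
  nlinarith

theorem HypSpace.lorentz_sq_le (y : HypSpace n) (a b : Minkowski n)
    (ha : lorentz y.vec a = 0) (hb : lorentz y.vec b = 0) :
    lorentz a b ^ 2 ≤ lorentz a a * lorentz b b := by
  have key : ∀ t : ℝ, 0 ≤ lorentz b b * (t * t) + (2 * lorentz a b) * t + lorentz a a := by
    intro t
    have h := y.lorentz_self_nonneg (a + t • b)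
      (by rw [lorentz_add_right, lorentz_smul_right, ha, hb]; ring)
    simp only [lorentz_add_left, lorentz_add_right, lorentz_smul_left, lorentz_smul_right] at h
    rw [lorentz_comm b a] at h
    linarith
  have h := discrim_le_zero key
  rw [discrim] at h
  nlinarith

theorem HypSpace.one_le (x y : HypSpace n) : 1 ≤ -lorentz x.vec y.vec := by
  have hx := x.norm_lt
  have hy := y.norm_lt
  have h1 := real_inner_le_norm x.vec.2 y.vec.2
  have ex := x.lorentz_self
  have ey := y.lorentz_self
  rw [lorentz, real_inner_self_eq_norm_sq] at ex ey
  rw [lorentz]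
  have h0 := norm_nonneg x.vec.2
  have h0' := norm_nonneg y.vec.2
  have h3 : ‖x.vec.2‖ * ‖y.vec.2‖ ≤ x.vec.1 * y.vec.1 :=
    mul_le_mul hx.le hy.le h0' x.time_pos.le
  nlinarith [sq_nonneg (x.vec.1 * ‖y.vec.2‖ - y.vec.1 * ‖x.vec.2‖),
    mul_nonneg h0 h0', mul_pos x.time_pos y.time_pos]

theorem HypSpace.eq_of_lorentz (x y : HypSpace n) (h : lorentz x.vec y.vec = -1) : x = y := by
  have hz : lorentz (x.vec - y.vec) (x.vec - y.vec) = 0 := by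
    simp only [lorentz_sub_left, lorentz_sub_right, x.lorentz_self, y.lorentz_self,
      lorentz_comm y.vec x.vec, h]
    ring
  have ho : lorentz x.vec (x.vec - y.vec) = 0 := by
    rw [lorentz_sub_right, x.lorentz_self, h]; ring
  set w := x.vec - y.vec with hw
  have h1 := x.norm_lt
  have h2 := abs_real_inner_le_norm x.vec.2 w.2
  rw [lorentz] at ho
  rw [lorentz, real_inner_self_eq_norm_sq] at hz
  have h3 : inner ℝ x.vec.2 w.2 = x.vec.1 * w.1 := by linarith
  rw [h3, abs_mul, abs_of_pos x.time_pos] at h2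
  have h7 : |w.1| = ‖w.2‖ := by
    rw [← abs_of_nonneg (norm_nonneg w.2)]
    exact (sq_eq_sq_iff_abs_eq_abs _ _).1 (by nlinarith)
  rw [h7] at h2
  have h8 : ‖w.2‖ = 0 := by nlinarith [norm_nonneg w.2]
  have h9 : w.1 = 0 := by rw [h8] at h7; exact abs_eq_zero.1 h7
  have h10 : w = 0 := Prod.ext h9 (norm_eq_zero.1 h8)
  exact HypSpace.ext (sub_eq_zero.1 (hw ▸ h10))

theorem HypSpace.triangle (x y z : HypSpace n) :
    Real.arcosh (-lorentz x.vec z.vec) ≤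
      Real.arcosh (-lorentz x.vec y.vec) + Real.arcosh (-lorentz y.vec z.vec) := by
  set u := -lorentz x.vec y.vec with hu
  set v := -lorentz y.vec z.vec with hv
  have hu1 : 1 ≤ u := x.one_le y
  have hv1 : 1 ≤ v := y.one_le z
  have hw1 := x.one_le z
  have hxy : lorentz x.vec y.vec = -u := by rw [hu]; ring
  have hyz : lorentz y.vec z.vec = -v := by rw [hv]; ring
  have hyx : lorentz y.vec x.vec = -u := by rw [lorentz_comm, hxy]
  have hzy : lorentz z.vec y.vec = -v := by rw [lorentz_comm, hyz]
  have cs := y.lorentz_sq_le (x.vec - u • y.vec) (z.vec - v • y.vec)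
    (by rw [lorentz_sub_right, lorentz_smul_right, y.lorentz_self, hyx]; ring)
    (by rw [lorentz_sub_right, lorentz_smul_right, y.lorentz_self, hyz]; ring)
  simp only [lorentz_sub_left, lorentz_sub_right, lorentz_smul_left, lorentz_smul_right,
    y.lorentz_self, x.lorentz_self, z.lorentz_self, hxy, hyz, hyx, hzy] at cs
  have cs2 : (lorentz x.vec z.vec + u * v) ^ 2 ≤ (u ^ 2 - 1) * (v ^ 2 - 1) := by
    nlinarith [cs]
  have cs3 : -(lorentz x.vec z.vec + u * v) ≤ √(u ^ 2 - 1) * √(v ^ 2 - 1) := by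
    rw [← Real.sqrt_mul (by nlinarith)]
    exact (neg_le_abs _).trans (Real.abs_le_sqrt cs2)
  have hA := Real.arcosh_nonneg hu1
  have hB := Real.arcosh_nonneg hv1
  have hC := Real.arcosh_nonneg hw1
  have : Real.cosh (Real.arcosh (-lorentz x.vec z.vec)) ≤
      Real.cosh (Real.arcosh u + Real.arcosh v) := by
    rw [Real.cosh_add, Real.cosh_arcosh hw1, Real.cosh_arcosh hu1, Real.cosh_arcosh hv1,
      Real.sinh_arcosh hu1, Real.sinh_arcosh hv1]
    linarith
  rw [Real.cosh_le_cosh, abs_of_nonneg hC, abs_of_nonneg (add_nonneg hA hB)] at this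
  exact this

end lorentzFacts

/-- The hyperbolic metric: `cosh (dist x y) = -⟨x, y⟩`. -/
instance HypSpace.instMetricSpace (n : ℕ) : MetricSpace (HypSpace n) where
  dist x y := Real.arcosh (-lorentz x.vec y.vec)
  dist_self x := by simp [x.lorentz_self]
  dist_comm x y := by rw [lorentz_comm]
  dist_triangle := HypSpace.triangle
  eq_of_dist_eq_zero := by
    intro x y h
    have h1 := (Real.arcosh_eq_zero_iff (x.one_le y)).1 h
    exact x.eq_of_lorentz y (by linarith)

theorem HypSpace.dist_def {n : ℕ} (x y : HypSpace n) :
    dist x y = Real.arcosh (-lorentz x.vec y.vec) := rfl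

namespace UnitNormal

variable {n : ℕ}

/-- The hyperplane orthogonal to `e`. -/
def hyperplane (e : UnitNormal n) : Set (HypSpace n) := {x | lorentz x.vec e.vec = 0}

/-- The closed half-space bounded by `e.hyperplane` for which `e` points outwards. -/
def halfSpace (e : UnitNormal n) : Set (HypSpace n) := {x | lorentz x.vec e.vec ≤ 0}

/-- The linear reflection `x ↦ x - 2 ⟨x, e⟩ e`. -/
def reflectVec (e : UnitNormal n) (x : Minkowski n) : Minkowski n :=
  x - (2 * lorentz x e.vec) • e.vec

theorem lorentz_reflectVec (e : UnitNormal n) (x y : Minkowski n) :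
    lorentz (e.reflectVec x) (e.reflectVec y) = lorentz x y := by
  simp only [reflectVec, lorentz_sub_left, lorentz_sub_right, lorentz_smul_left,
    lorentz_smul_right, e.lorentz_self, lorentz_comm e.vec y]
  ring

theorem reflectVec_reflectVec (e : UnitNormal n) (x : Minkowski n) :
    e.reflectVec (e.reflectVec x) = x := by
  have h : lorentz (e.reflectVec x) e.vec = -lorentz x e.vec := by
    simp only [reflectVec, lorentz_sub_left, lorentz_smul_left, e.lorentz_self]; ring
  rw [reflectVec, h, reflectVec]
  module

theorem reflectVec_comm (e f : UnitNormal n) (h : lorentz e.vec f.vec = 0) (x : Minkowski n) :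
    e.reflectVec (f.reflectVec x) = f.reflectVec (e.reflectVec x) := by
  have h' : lorentz f.vec e.vec = 0 := by rw [lorentz_comm, h]
  simp only [reflectVec, lorentz_sub_left, lorentz_smul_left, h, h']
  module

/-- The reflection of hyperbolic space in the hyperplane orthogonal to `e`, as a map. -/
def reflectFun (e : UnitNormal n) (x : HypSpace n) : HypSpace n where
  vec := e.reflectVec x.vec
  lorentz_self := by rw [lorentz_reflectVec, x.lorentz_self]
  time_pos := by
    by_contra hneg
    have hx := x.norm_lt
    have h1 : lorentz x.vec (e.reflectVec x.vec) ≤ -1 := by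
      rw [reflectVec, lorentz_sub_right, lorentz_smul_right, x.lorentz_self]
      nlinarith [sq_nonneg (lorentz x.vec e.vec)]
    have h2 : lorentz (e.reflectVec x.vec) (e.reflectVec x.vec) = -1 := by
      rw [lorentz_reflectVec, x.lorentz_self]
    set y := e.reflectVec x.vec with hy
    rw [lorentz, real_inner_self_eq_norm_sq] at h2
    rw [lorentz] at h1
    have h3 := abs_le.1 (abs_real_inner_le_norm x.vec.2 y.2)
    have h4 : ‖y.2‖ ≤ -y.1 := by
      have := norm_nonneg y.2
      nlinarith
    have h5 : ‖x.vec.2‖ * ‖y.2‖ ≤ x.vec.1 * -y.1 :=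
      mul_le_mul hx.le h4 (norm_nonneg _) x.time_pos.le
    nlinarith [h3.1]

/-- The reflection of hyperbolic space in the hyperplane orthogonal to `e`. -/
def reflection (e : UnitNormal n) : HypSpace n ≃ᵢ HypSpace n where
  toFun := e.reflectFun
  invFun := e.reflectFun
  left_inv x := HypSpace.ext (e.reflectVec_reflectVec x.vec)
  right_inv x := HypSpace.ext (e.reflectVec_reflectVec x.vec)
  isometry_toFun := Isometry.of_dist_eq fun x y => by
    simp only [HypSpace.dist_def, reflectFun, lorentz_reflectVec]

theorem reflection_mul_self (e : UnitNormal n) : e.reflection * e.reflection = 1 := by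
  ext x : 1
  exact HypSpace.ext (e.reflectVec_reflectVec x.vec)

theorem reflection_comm (e f : UnitNormal n) (h : lorentz e.vec f.vec = 0) :
    e.reflection * f.reflection = f.reflection * e.reflection := by
  ext x : 1
  exact HypSpace.ext (e.reflectVec_comm f h x.vec)

end UnitNormal

/-! ### Polytopes -/

/-- A facet of `P` (a face of codimension one), recorded by its outward unit normal: `P` lies in
the half-space, and `P ∩ hyperplane` has non-empty interior in the hyperplane. When `P` has
non-empty interior, a facet determines its outward unit normal. -/
@[ext]
structure Facet {n : ℕ} (P : Set (HypSpace n)) where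
  normal : UnitNormal n
  subset_halfSpace : P ⊆ normal.halfSpace
  full : ∃ x ∈ normal.hyperplane, ∃ ε > 0, Metric.ball x ε ∩ normal.hyperplane ⊆ P

namespace Facet

variable {n : ℕ} {P : Set (HypSpace n)}

/-- The facet as a set of points. -/
def carrier (F : Facet P) : Set (HypSpace n) := P ∩ F.normal.hyperplane

/-- Two distinct facets are adjacent if they share a face of codimension two. -/
def Adjacent (F G : Facet P) : Prop :=
  F ≠ G ∧ ∃ x ∈ F.normal.hyperplane ∩ G.normal.hyperplane, ∃ ε > 0,
    Metric.ball x ε ∩ (F.normal.hyperplane ∩ G.normal.hyperplane) ⊆ P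

/-- The interior dihedral angle of `P` between two adjacent facets: the outward unit normals
satisfy `⟨e, f⟩ = - cos θ`. -/
def dihedralAngle (F G : Facet P) : ℝ :=
  Real.arccos (-lorentz F.normal.vec G.normal.vec)

end Facet

/-- A compact convex right-angled polytope in `HypSpace n`: a compact finite intersection of closed
half-spaces, with non-empty interior, all of whose dihedral angles are `π / 2`. -/
structure RightAngledPolytope (n : ℕ) where
  carrier : Set (HypSpace n)
  isCompact : IsCompact carrier
  interior_nonempty : (interior carrier).Nonempty
  finite_halfSpaces : ∃ S : Set (UnitNormal n), S.Finite ∧ carrier = ⋂ e ∈ S, e.halfSpace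
  right_angled : ∀ F G : Facet carrier, F.Adjacent G → F.dihedralAngle G = Real.pi / 2

namespace RightAngledPolytope

variable {n : ℕ} (P : RightAngledPolytope n)

/-- A vertex: a point `v` of `P` such that the face of `P` cut out by the facets through `v`
is `{v}`. -/
def IsVertex (v : HypSpace n) : Prop :=
  v ∈ P.carrier ∧
    ∀ y ∈ P.carrier, (∀ F : Facet P.carrier, v ∈ F.carrier → y ∈ F.carrier) → y = v

/-- The relators `r_F²` for all facets `F`, and `[r_F, r_G]` for all adjacent facets `F`, `G`. -/
def relators : Set (FreeGroup (Facet P.carrier)) :=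
  {w | ∃ F, w = FreeGroup.of F ^ 2} ∪
    {w | ∃ F G : Facet P.carrier, F.Adjacent G ∧ 
      w = FreeGroup.of F * FreeGroup.of G * (FreeGroup.of F)⁻¹ * (FreeGroup.of G)⁻¹}

/-- The right-angled Coxeter group `Γ` of `P`. -/
abbrev coxeterGroup : Type := PresentedGroup P.relators

theorem lift_reflection_relators (w : FreeGroup (Facet P.carrier)) (hw : w ∈ P.relators) :
    FreeGroup.lift (fun F : Facet P.carrier => F.normal.reflection) w = 1 := by
  rcases hw with ⟨F, rfl⟩ | ⟨F, G, h, rfl⟩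
  · rw [map_pow, FreeGroup.lift_apply_of, pow_two, UnitNormal.reflection_mul_self]
  · simp only [map_mul, map_inv, FreeGroup.lift_apply_of]
    rw [mul_inv_eq_one, mul_inv_eq_iff_eq_mul]
    apply UnitNormal.reflection_comm
    have h1 := P.right_angled F G h
    rw [Facet.dihedralAngle, Real.arccos_eq_pi_div_two] at h1
    linarith

/-- `Γ` acts on hyperbolic space by isometries, the generator of a facet `F` acting as the
reflection in the hyperplane containing `F`. -/
def reflectionHom : P.coxeterGroup →* (HypSpace n ≃ᵢ HypSpace n) :=
  PresentedGroup.toGroup P.lift_reflection_relators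

instance : MulAction P.coxeterGroup (HypSpace n) where
  smul g x := P.reflectionHom g x
  one_smul x := by
    change P.reflectionHom 1 x = x
    rw [map_one]; rfl
  mul_smul g h x := by
    change P.reflectionHom (g * h) x = P.reflectionHom g (P.reflectionHom h x)
    rw [map_mul]; rfl

instance : IsIsometricSMul P.coxeterGroup (HypSpace n) where
  isometry_smul g := (P.reflectionHom g).isometry

instance (H : Subgroup P.coxeterGroup) : IsIsometricSMul H (HypSpace n) where
  isometry_smul g := (P.reflectionHom g).isometry

end RightAngledPolytope

/-! ### Quotients of metric spaces by isometric actions -/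

/-- The space of orbits of `G` on `X`. -/
def OrbitSpace (G X : Type*) [Group G] [MulAction G X] : Type _ :=
  MulAction.orbitRel.Quotient G X

namespace OrbitSpace

variable (G : Type*) {X : Type*} [Group G]

/-- The projection to the space of orbits. -/
def proj [MulAction G X] (x : X) : OrbitSpace G X :=
  Quotient.mk (MulAction.orbitRel G X) x

theorem proj_surjective [MulAction G X] : Function.Surjective (proj G : X → OrbitSpace G X) :=
  Quotient.mk_surjective

theorem bddBelow_dist [PseudoMetricSpace X] [MulAction G X] (x y : X) :
    BddBelow (Set.range fun g : G => dist x (g • y)) :=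
  ⟨0, by rintro _ ⟨g, rfl⟩; exact dist_nonneg⟩

variable [PseudoMetricSpace X] [MulAction G X] [IsIsometricSMul G X]

theorem iInf_dist_congr (a b a' b' : X) (ha : a ∈ MulAction.orbit G a')
    (hb : b ∈ MulAction.orbit G b') : ⨅ g : G, dist a (g • b) = ⨅ g : G, dist a' (g • b') := by
  obtain ⟨k, rfl⟩ := ha
  obtain ⟨l, rfl⟩ := hb
  refine Function.Surjective.iInf_congr (fun g : G => k⁻¹ * g * l)
    (fun g => ⟨k * g * l⁻¹, by simp [mul_assoc]⟩) fun g => ?_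
  simp only [mul_smul]
  rw [← dist_smul k, smul_inv_smul]

/-- The distance between two orbits is the infimum of the distances between their points. -/
instance : Dist (OrbitSpace G X) where
  dist p q := Quotient.liftOn₂ p q (fun x y => ⨅ g : G, dist x (g • y))
    (fun a b a' b' ha hb => iInf_dist_congr G a b a' b' ha hb)

theorem dist_proj (x y : X) : dist (proj G x) (proj G y) = ⨅ g : G, dist x (g • y) := rfl

instance : PseudoMetricSpace (OrbitSpace G X) where
  dist_self p := by
    obtain ⟨x, rfl⟩ := proj_surjective G p
    rw [dist_proj]
    refine le_antisymm ?_ (Real.iInf_nonneg fun _ => dist_nonneg)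
    exact (ciInf_le (bddBelow_dist G x x) 1).trans (by simp)
  dist_comm p q := by
    obtain ⟨x, rfl⟩ := proj_surjective G p
    obtain ⟨y, rfl⟩ := proj_surjective G q
    rw [dist_proj, dist_proj]
    refine Function.Surjective.iInf_congr (fun g : G => g⁻¹) inv_surjective fun g => ?_
    rw [dist_comm, ← dist_smul g, smul_inv_smul]
  dist_triangle p q r := by
    obtain ⟨x, rfl⟩ := proj_surjective G p
    obtain ⟨y, rfl⟩ := proj_surjective G q
    obtain ⟨z, rfl⟩ := proj_surjective G r
    rw [dist_proj, dist_proj, dist_proj]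
    refine le_ciInf_add_ciInf fun g h => ?_
    refine (ciInf_le (bddBelow_dist G x z) (g * h)).trans ?_
    refine (dist_triangle x (g • y) _).trans ?_
    rw [mul_smul, dist_smul]

end OrbitSpace

/-! ### Colourings and the associated manifolds -/

/-- A `V`-colouring: a vector for each facet, such that at every vertex the colours of the facets
through it are linearly independent. -/
@[ext]
structure Colouring {n : ℕ} (P : RightAngledPolytope n) (V : Type*) [AddCommGroup V]
    [Module (ZMod 2) V] where
  colour : Facet P.carrier → V
  linearIndependent : ∀ v, P.IsVertex v →
    LinearIndependent (ZMod 2) (fun F : {F : Facet P.carrier // v ∈ F.carrier} => colour F.1)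

namespace Colouring

variable {n : ℕ} {P : RightAngledPolytope n} {V : Type*} [AddCommGroup V] [Module (ZMod 2) V]
  (col : Colouring P V)

theorem lift_colour_relators (w : FreeGroup (Facet P.carrier)) (hw : w ∈ P.relators) :
    FreeGroup.lift (fun F => Multiplicative.ofAdd (col.colour F)) w = 1 := by
  rcases hw with ⟨F, rfl⟩ | ⟨F, G, _, rfl⟩
  · rw [map_pow, FreeGroup.lift_apply_of, pow_two, ← ofAdd_add, ZModModule.add_self, ofAdd_zero]
  · simp only [map_mul, map_inv, FreeGroup.lift_apply_of]
    rw [mul_inv_eq_one, mul_inv_eq_iff_eq_mul, mul_comm]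

/-- The homomorphism `Γ → V` induced by the colouring: it sends `r_F` to the colour of `F`. -/
def hom : P.coxeterGroup →* Multiplicative V :=
  PresentedGroup.toGroup col.lift_colour_relators

/-- The kernel `Γ_λ` of the homomorphism `Γ → V`. -/
abbrev kernel : Subgroup P.coxeterGroup := col.hom.ker

/-- The space `M_λ = ℍⁿ / Γ_λ`, with the quotient metric. -/
abbrev Mfd : Type := OrbitSpace col.kernel (HypSpace n)

/-- The projection `ℍⁿ → M_λ`. -/
def proj (x : HypSpace n) : col.Mfd := OrbitSpace.proj col.kernel x

/-- `c` is the natural orbifold covering `M_λ = ℍⁿ / Γ_λ → ℍⁿ / Γ = P`: it sends the class of `x`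
to a point of `P` in the `Γ`-orbit of `x`. -/
def IsCover (c : col.Mfd → P.carrier) : Prop :=
  ∀ x : HypSpace n, (c (col.proj x) : HypSpace n) ∈ MulAction.orbit P.coxeterGroup x

end Colouring

/-- `j : ℍⁿ → ℍⁿ⁺¹` identifies the polytope `Q ⊆ ℍⁿ` isometrically with the facet `F` of
`P ⊆ ℍⁿ⁺¹`, and `ℍⁿ` with the hyperplane containing `F`. -/
def IsFacetModel {n : ℕ} {P : RightAngledPolytope (n + 1)} (F : Facet P.carrier)
    (Q : RightAngledPolytope n) (j : HypSpace n → HypSpace (n + 1)) : Prop :=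
  Isometry j ∧ Set.range j = F.normal.hyperplane ∧ j '' Q.carrier = F.carrier

/-- `μ` is the colouring of the facet `F` (in the form of `Q` and `j`) with values in
`V / ⟨λ_F⟩` induced by the colouring `col` of `P`: each face of codimension one of `F` is of the form
`F ∩ G` for a facet `G ≠ F` of `P`, and receives the class of the colour of `G`. -/
def IsInducedColouring {n : ℕ} {P : RightAngledPolytope (n + 1)} {V : Type*} [AddCommGroup V]
    [Module (ZMod 2) V] (col : Colouring P V) (F : Facet P.carrier)
    {Q : RightAngledPolytope n} (j : HypSpace n → HypSpace (n + 1))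
    (μ : Colouring Q (V ⧸ Submodule.span (ZMod 2) {col.colour F})) : Prop :=
  ∀ E : Facet Q.carrier, ∃ G : Facet P.carrier, G ≠ F ∧
    j '' E.carrier = F.carrier ∩ G.carrier ∧
    μ.colour E = Submodule.Quotient.mk (col.colour G)

/-! ### Hyperbolic manifolds and totally geodesic submanifolds -/

/-- A hyperbolic chart: a homeomorphism between open sets that preserves distances. -/
def IsHypChart {n : ℕ} {M : Type*} [PseudoMetricSpace M]
    (φ : OpenPartialHomeomorph M (HypSpace n)) : Prop :=
  ∀ p ∈ φ.source, ∀ q ∈ φ.source, dist (φ p) (φ q) = dist p q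

/-- A hyperbolic `n`-manifold (without boundary): a Hausdorff, second countable space that is
locally isometric to hyperbolic `n`-space. -/
def IsHyperbolicManifold (n : ℕ) (M : Type*) [PseudoMetricSpace M] : Prop :=
  T2Space M ∧ SecondCountableTopology M ∧
    ∀ p : M, ∃ φ : OpenPartialHomeomorph M (HypSpace n), IsHypChart φ ∧ p ∈ φ.source

/-- `γ` is a geodesic (parametrized with constant speed, locally minimizing) on `I`. -/
def IsGeodesicOn {M : Type*} [PseudoMetricSpace M] (γ : ℝ → M) (I : Set ℝ) : Prop :=
  ∃ c : ℝ, 0 ≤ c ∧ ∀ t ∈ I, ∃ ε > 0, ∀ s ∈ I, ∀ s' ∈ I, |s - t| < ε → |s' - t| < ε →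
    dist (γ s) (γ s') = c * |s - s'|

/-- `ι : N → M` embeds the hyperbolic `k`-manifold `N` in the hyperbolic `n`-manifold `M` as a
totally geodesic submanifold: it is a topological embedding, it is modelled in suitable hyperbolic
charts on an isometric inclusion of `ℍᵏ` in `ℍⁿ` (in particular it is a smooth submanifold, and
`ι` is a Riemannian isometry onto it), and every geodesic of `N` is a geodesic of `M`. -/
structure IsTotallyGeodesicEmbedding (k n : ℕ) {N M : Type*} [PseudoMetricSpace N]
    [PseudoMetricSpace M] (ι : N → M) : Prop where
  isEmbedding : Topology.IsEmbedding ι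
  charts : ∀ p : N, ∃ (φ : OpenPartialHomeomorph N (HypSpace k))
    (ψ : OpenPartialHomeomorph M (HypSpace n)) (i : HypSpace k → HypSpace n),
    IsHypChart φ ∧ IsHypChart ψ ∧ Isometry i ∧ p ∈ φ.source ∧ φ.source = ι ⁻¹' ψ.source ∧
    (∀ q ∈ φ.source, ψ (ι q) = i (φ q)) ∧
    ψ '' (ψ.source ∩ Set.range ι) = ψ.target ∩ Set.range i
  map_geodesic : ∀ (γ : ℝ → N) (I : Set ℝ), I.OrdConnected → IsGeodesicOn γ I →
    IsGeodesicOn (ι ∘ γ) I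

end

/-! The foundation is that `P` is a strict fundamental domain for `Γ`. A facet is cut out of its
hyperplane by the facets adjacent to it, all orthogonal to it, so the orthogonal projection of `P`
to that hyperplane stays in `P`. Hence the outward normals of distinct facets have product `0` when
the facets are adjacent and at most `-1` otherwise (`adjacent_or_lorentz_le`). Induction on word
length then decides on which side of the hyperplane of `F` the translate `g P` lies, according to
whether `r_F` lengthens or shortens `g` (`lorentz_smul_nonpos_aux`). So an element that brings a
point of `P` back into `P` fixes it, and is a product of reflections in facets through it
(`smul_eq_and_mem_closure`).

The colours of the facets through a point of `P` are independent, so non-trivial elements of its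
stabilizer have non-zero colour. Therefore `Γ_λ` acts freely (`eq_one_of_smul_eq`), the projection
to `M_λ` is a local isometry, and the folding map onto `P` descends to the cover.

For the facet, the normals of the adjacent facets are tangent to `H` and give the facets of `F`,
with the same products; this yields a homomorphism from `Γ_F` to `Γ`. What remains is to compare
kernels. An element of `(Γ_F)_μ` has colour `0` or `λ_F` in `V`, and the second case is corrected by
`r_F`, which is the identity on `H` (`exists_mem_kernel`); so `ι` is well defined. Conversely,
points of `H` identified by `Γ_λ` are identified by `(Γ_F)_μ`, because the stabilizer in `Γ` of a
point of `F` is, up to `r_F`, the one in `Γ_F` (`exists_mem_kernel_smul_eq`); so `ι` is injective.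
By local finiteness and freeness, translates of points of `H` under `Γ_λ` that come close to a given
point of `H` are translates under `(Γ_F)_μ` (`exists_ball_mem_kernel`), so in charts the image of
`ι` is a hyperplane. -/

theorem continuous_lorentz_left {n : ℕ} (w : Minkowski n) :
    Continuous fun v : Minkowski n => lorentz v w := by
  unfold lorentz; fun_prop

theorem lorentz_zero_left {n : ℕ} (w : Minkowski n) : lorentz 0 w = 0 := by
  simp [lorentz]

theorem lorentz_zero_right {n : ℕ} (w : Minkowski n) : lorentz w 0 = 0 := by
  simp [lorentz]

/-! ### Topology of the hyperboloid and motion along geodesics -/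

namespace HypSpace

open Topology Filter

variable {n : ℕ}

theorem cosh_dist (x y : HypSpace n) : Real.cosh (dist x y) = -lorentz x.vec y.vec := by
  rw [dist_def, Real.cosh_arcosh (x.one_le y)]

theorem dist_lt_iff (x y : HypSpace n) {r : ℝ} (hr : 0 ≤ r) :
    dist x y < r ↔ -lorentz x.vec y.vec < Real.cosh r := by
  rw [← cosh_dist, Real.cosh_lt_cosh, abs_of_nonneg dist_nonneg, abs_of_nonneg hr]

theorem dist_lt_dist_iff (x y x' y' : HypSpace n) :
    dist x y < dist x' y' ↔ lorentz x'.vec y'.vec < lorentz x.vec y.vec := by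
  rw [dist_lt_iff x y dist_nonneg, cosh_dist, neg_lt_neg_iff]

theorem dist_eq_dist_iff {m : ℕ} (x y : HypSpace n) (x' y' : HypSpace m) :
    dist x y = dist x' y' ↔ lorentz x.vec y.vec = lorentz x'.vec y'.vec := by
  constructor
  · intro h
    have := cosh_dist x y
    rw [h, cosh_dist] at this
    linarith
  · intro h
    rw [dist_def, dist_def, h]

/-- Cauchy–Schwarz on `x⊥` for the components of `y` and `w` orthogonal to `x`. As `y → x` the right
side tends to zero, which makes linear functionals continuous for the hyperbolic metric. -/
theorem lorentz_sub_mul_sq_le (x y : HypSpace n) (w : Minkowski n) :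
    (lorentz y.vec w - Real.cosh (dist x y) * lorentz x.vec w) ^ 2 ≤
      (Real.cosh (dist x y) ^ 2 - 1) * (lorentz w w + lorentz x.vec w ^ 2) := by
  rw [cosh_dist]
  have h := x.lorentz_sq_le (y.vec + lorentz x.vec y.vec • x.vec) (w + lorentz x.vec w • x.vec)
    (by rw [lorentz_add_right, lorentz_smul_right, x.lorentz_self]; ring)
    (by rw [lorentz_add_right, lorentz_smul_right, x.lorentz_self]; ring)
  simp only [lorentz_add_left, lorentz_add_right, lorentz_smul_left, lorentz_smul_right,
    x.lorentz_self, y.lorentz_self, lorentz_comm y.vec x.vec, lorentz_comm w x.vec] at h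
  nlinarith [h]

theorem continuous_lorentz (w : Minkowski n) :
    Continuous fun y : HypSpace n => lorentz y.vec w := by
  rw [continuous_iff_continuousAt]
  intro x
  have hu : Tendsto (fun y : HypSpace n => Real.cosh (dist x y)) (𝓝 x) (𝓝 1) := by
    have : Continuous fun y : HypSpace n => Real.cosh (dist x y) := by fun_prop
    simpa using this.tendsto x
  have h1 : Tendsto (fun y : HypSpace n => √((Real.cosh (dist x y) ^ 2 - 1) *
      (lorentz w w + lorentz x.vec w ^ 2))) (𝓝 x) (𝓝 0) := by
    have := (((hu.pow 2).sub_const 1).mul_const (lorentz w w + lorentz x.vec w ^ 2)).sqrt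
    simpa using this
  have h2 : Tendsto (fun y : HypSpace n =>
      lorentz y.vec w - Real.cosh (dist x y) * lorentz x.vec w) (𝓝 x) (𝓝 0) :=
    squeeze_zero_norm (fun y => Real.abs_le_sqrt (lorentz_sub_mul_sq_le x y w)) h1
  have h3 := h2.add (hu.mul_const (lorentz x.vec w))
  simpa [ContinuousAt] using h3

theorem continuous_vec : Continuous (HypSpace.vec : HypSpace n → Minkowski n) := by
  refine Continuous.prodMk ?_ ?_
  · have h := (continuous_lorentz (n := n) (-1, 0))
    simpa [lorentz] using h
  · have h : Continuous fun y : HypSpace n => WithLp.toLp 2 fun i => y.vec.2 i := by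
      refine (PiLp.continuous_toLp 2 _).comp (continuous_pi fun i => ?_)
      have h := continuous_lorentz (n := n) (0, EuclideanSpace.single i 1)
      simpa [lorentz, EuclideanSpace.inner_single_right] using h
    exact h

/-- Transfers second countability and properness from Minkowski space. The image is closed because
the time coordinate cannot vanish on the hyperboloid, so the strict sign condition may be relaxed.
-/
theorem isClosedEmbedding_vec : IsClosedEmbedding (HypSpace.vec : HypSpace n → Minkowski n) := by
  refine ⟨⟨isInducing_iff_nhds.2 fun x => le_antisymm continuous_vec.continuousAt.le_comap ?_,
    fun x y h => HypSpace.ext h⟩, ?_⟩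
  · rw [Metric.nhds_basis_ball.ge_iff]
    intro ε hε
    have hc : Continuous fun v : Minkowski n => -lorentz v x.vec :=
      (continuous_lorentz_left x.vec).neg
    have : ∀ᶠ v in 𝓝 x.vec, -lorentz v x.vec < Real.cosh ε := by
      refine hc.tendsto x.vec |>.eventually_lt_const ?_
      rw [x.lorentz_self, neg_neg]
      exact Real.one_lt_cosh.2 hε.ne'
    filter_upwards [this.comap (HypSpace.vec)] with y hy
    exact (dist_lt_iff y x hε.le).2 hy
  · have : Set.range (HypSpace.vec : HypSpace n → Minkowski n) =
        {v | lorentz v v = -1} ∩ {v | 0 ≤ v.1} := by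
      ext v
      constructor
      · rintro ⟨x, rfl⟩
        exact ⟨x.lorentz_self, x.time_pos.le⟩
      · rintro ⟨h1, h2⟩
        refine ⟨⟨v, h1, lt_of_le_of_ne h2 fun h => ?_⟩, rfl⟩
        have h1' : lorentz v v = -1 := h1
        rw [lorentz, ← h, real_inner_self_eq_norm_sq] at h1'
        nlinarith [norm_nonneg v.2]
    rw [this]
    refine IsClosed.inter (isClosed_eq ?_ continuous_const) (isClosed_le continuous_const
      continuous_fst)
    unfold lorentz; fun_prop

/-- The point `(1, 0)` of the hyperboloid. -/
def origin (n : ℕ) : HypSpace n where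
  vec := (1, 0)
  lorentz_self := by simp [lorentz]
  time_pos := one_pos

instance : SecondCountableTopology (HypSpace n) :=
  isClosedEmbedding_vec.isEmbedding.secondCountableTopology

instance : ProperSpace (HypSpace n) := by
  refine ProperSpace.of_seq_closedBall (β := ℕ) (l := atTop) (x := origin n) (r := fun k => (k : ℝ))
    tendsto_natCast_atTop_atTop (Eventually.of_forall fun k => ?_)
  refine (isClosedEmbedding_vec.isCompact_preimage
    (isCompact_closedBall (0 : Minkowski n) (Real.cosh k))).of_isClosed_subset
    Metric.isClosed_closedBall fun x hx => ?_
  have h1 : x.vec.1 = Real.cosh (dist x (origin n)) := by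
    rw [cosh_dist]; simp [lorentz, origin]
  have h2 : x.vec.1 ≤ Real.cosh k := by
    rw [h1, Real.cosh_le_cosh, abs_of_nonneg dist_nonneg, abs_of_nonneg (Nat.cast_nonneg k)]
    exact hx
  rw [Set.mem_preimage, mem_closedBall_zero_iff, Prod.norm_def]
  refine max_le ?_ (x.norm_lt.le.trans h2)
  rwa [Real.norm_of_nonneg x.time_pos.le]

theorem time_pos_of_timelike (x : HypSpace n) (v : Minkowski n) (hv : lorentz v v < 0)
    (hx : lorentz x.vec v < 0) : 0 < v.1 := by
  by_contra hneg
  rw [lorentz, real_inner_self_eq_norm_sq] at hv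
  rw [lorentz] at hx
  have h1 : ‖v.2‖ ≤ -v.1 := by nlinarith [norm_nonneg v.2]
  have h2 := abs_le.1 (abs_real_inner_le_norm x.vec.2 v.2)
  have h3 : ‖x.vec.2‖ * ‖v.2‖ ≤ x.vec.1 * -v.1 :=
    mul_le_mul x.norm_lt.le h1 (norm_nonneg _) x.time_pos.le
  linarith [h2.1]

/-- Future-directed time-like vectors are positive multiples of points of hyperbolic space. -/
theorem exists_vec_eq_smul (x : HypSpace n) (v : Minkowski n) (hv : lorentz v v < 0)
    (hx : lorentz x.vec v < 0) : ∃ y : HypSpace n, ∃ c > (0 : ℝ), y.vec = c • v := by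
  have h0 : 0 < √(-lorentz v v) := Real.sqrt_pos.2 (by linarith)
  have h1 : √(-lorentz v v) * √(-lorentz v v) = -lorentz v v :=
    Real.mul_self_sqrt (by linarith)
  refine ⟨⟨(√(-lorentz v v))⁻¹ • v, ?_, ?_⟩, (√(-lorentz v v))⁻¹, inv_pos.2 h0, rfl⟩
  · rw [lorentz_smul_left, lorentz_smul_right]
    have : lorentz v v = -(√(-lorentz v v) * √(-lorentz v v)) := by linarith
    field_simp
    linarith
  · exact mul_pos (inv_pos.2 h0) (time_pos_of_timelike x v hv hx)

/-- The points of the geodesic segment from `x` to `y`, as radial projections of the chord. -/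
theorem exists_vec_eq_smul_add (x y : HypSpace n) {a b : ℝ} (ha : 0 < a) (hb : 0 ≤ b) :
    ∃ z : HypSpace n, ∃ c > (0 : ℝ), z.vec = c • (a • x.vec + b • y.vec) := by
  have h := x.one_le y
  apply exists_vec_eq_smul x
  · simp only [lorentz_add_left, lorentz_add_right, lorentz_smul_left, lorentz_smul_right,
      x.lorentz_self, y.lorentz_self, lorentz_comm y.vec x.vec]
    nlinarith [mul_nonneg ha.le hb, mul_pos ha ha, mul_nonneg hb hb,
      mul_nonneg (mul_nonneg ha.le hb) (by linarith : 0 ≤ -lorentz x.vec y.vec)]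
  · simp only [lorentz_add_right, lorentz_smul_right, x.lorentz_self]
    nlinarith

/-- The point reached from `z` in the direction of the tangent vector `w`. -/
theorem exists_vec_eq_add (z : HypSpace n) (w : Minkowski n) (hw : lorentz z.vec w = 0) :
    ∃ y : HypSpace n, y.vec = √(1 + lorentz w w) • z.vec + w := by
  have h0 := z.lorentz_self_nonneg w hw
  have h1 : √(1 + lorentz w w) * √(1 + lorentz w w) = 1 + lorentz w w :=
    Real.mul_self_sqrt (by linarith)
  have h2 : 0 < √(1 + lorentz w w) := Real.sqrt_pos.2 (by linarith)
  have key : lorentz (√(1 + lorentz w w) • z.vec + w) (√(1 + lorentz w w) • z.vec + w) = -1 := by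
    simp only [lorentz_add_left, lorentz_add_right, lorentz_smul_left, lorentz_smul_right,
      z.lorentz_self, lorentz_comm w z.vec, hw]
    linarith
  refine ⟨⟨_, key, ?_⟩, rfl⟩
  refine time_pos_of_timelike z _ (by linarith) ?_
  rw [lorentz_add_right, lorentz_smul_right, z.lorentz_self, hw]
  linarith

theorem exists_mem_ball_vec_eq (z : HypSpace n) (w : Minkowski n) (hw : lorentz z.vec w = 0)
    {ε : ℝ} (hε : 0 < ε) :
    ∃ y ∈ Metric.ball z ε, ∃ c > (0 : ℝ), ∃ t > (0 : ℝ), y.vec = c • z.vec + t • w := by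
  have h0 := z.lorentz_self_nonneg w hw
  have hc : Continuous fun t : ℝ => √(1 + lorentz (t • w) (t • w)) := by
    simp only [lorentz_smul_left, lorentz_smul_right]; fun_prop
  have h1 : ∀ᶠ t in 𝓝 (0 : ℝ), √(1 + lorentz (t • w) (t • w)) < Real.cosh ε := by
    refine (hc.tendsto 0).eventually_lt_const ?_
    simpa [lorentz_zero_left] using hε.ne'
  obtain ⟨t, ht, ht0⟩ := ((h1.filter_mono nhdsWithin_le_nhds).and
    (self_mem_nhdsWithin : Set.Ioi (0 : ℝ) ∈ 𝓝[>] 0)).exists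
  obtain ⟨y, hy⟩ := z.exists_vec_eq_add (t • w) (by rw [lorentz_smul_right, hw, mul_zero])
  refine ⟨y, ?_, _, ?_, t, ht0, hy⟩
  · have hzt : lorentz z.vec (t • w) = 0 := by rw [lorentz_smul_right, hw, mul_zero]
    rw [Metric.mem_ball, dist_comm, dist_lt_iff z y hε.le, hy, lorentz_add_right, hzt,
      lorentz_smul_right, z.lorentz_self]
    linarith
  · refine Real.sqrt_pos.2 ?_
    rw [lorentz_smul_left, lorentz_smul_right]
    nlinarith [mul_nonneg (mul_self_nonneg t) h0]

theorem eq_zero_of_lorentz_self_eq_zero (z : HypSpace n) (w : Minkowski n)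
    (hw : lorentz z.vec w = 0) (h : lorentz w w = 0) : w = 0 := by
  obtain ⟨y, hy⟩ := z.exists_vec_eq_add w hw
  rw [h, add_zero, Real.sqrt_one, one_smul] at hy
  have : z = y := by
    apply z.eq_of_lorentz
    rw [hy, lorentz_add_right, hw, z.lorentz_self, add_zero]
  rw [← this] at hy
  simpa using hy

/-- A vector orthogonal to `z` whose product is nowhere positive near `z` in a hyperplane through
`z` is normal to this hyperplane. -/
theorem eq_smul_of_nonpos_on_ball (z : HypSpace n) (f : UnitNormal n) (w : Minkowski n)
    (hf : lorentz z.vec f.vec = 0) (hw : lorentz z.vec w = 0) {ε : ℝ} (hε : 0 < ε)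
    (h : ∀ y ∈ Metric.ball z ε, lorentz y.vec f.vec = 0 → lorentz y.vec w ≤ 0) :
    w = lorentz w f.vec • f.vec := by
  -- The component of `w` tangent to the hyperplane. Moving from `z` in this direction stays in the
  -- hyperplane and changes the product with `w` by a positive multiple of `lorentz w' w'`, which
  -- must therefore vanish.
  set w' := w - lorentz w f.vec • f.vec with hw'
  have h1 : lorentz z.vec w' = 0 := by
    rw [hw', lorentz_sub_right, lorentz_smul_right, hf, hw]; ring
  have h2 : lorentz w' f.vec = 0 := by
    rw [hw', lorentz_sub_left, lorentz_smul_left, f.lorentz_self]; ring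
  have h3 : lorentz w' w' = lorentz w' w := by
    conv_lhs => rw [hw']
    rw [lorentz_comm, lorentz_sub_left, lorentz_smul_left, lorentz_comm f.vec, h2, lorentz_comm w]
    ring
  obtain ⟨y, hy, c, hc, t, ht, hyv⟩ := z.exists_mem_ball_vec_eq w' h1 hε
  have h4 := h y hy (by
    rw [hyv, lorentz_add_left, lorentz_smul_left, lorentz_smul_left, hf, h2]; ring)
  rw [hyv, lorentz_add_left, lorentz_smul_left, lorentz_smul_left, hw, ← h3] at h4
  have h5 := z.lorentz_self_nonneg w' h1
  have h6 : lorentz w' w' = 0 := by nlinarith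
  exact sub_eq_zero.1 (z.eq_zero_of_lorentz_self_eq_zero w' h1 h6)

/-- From a point on the bounding hyperplane, a small move along `e` would leave the half-space. -/
theorem lorentz_neg_of_mem_interior {P : Set (HypSpace n)} {x : HypSpace n} (hx : x ∈ interior P)
    (e : UnitNormal n) (he : P ⊆ e.halfSpace) : lorentz x.vec e.vec < 0 := by
  refine lt_of_le_of_ne (he (interior_subset hx)) fun h => ?_
  obtain ⟨ε, hε, hb⟩ := Metric.mem_nhds_iff.1 (mem_interior_iff_mem_nhds.1 hx)
  obtain ⟨y, hy, c, hc, t, ht, hyv⟩ := x.exists_mem_ball_vec_eq e.vec h hε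
  have h1 : lorentz y.vec e.vec ≤ 0 := he (hb hy)
  rw [hyv, lorentz_add_left, lorentz_smul_left, lorentz_smul_left, h, e.lorentz_self] at h1
  linarith

/-- Strict inequalities at a point persist in a ball. -/
theorem exists_ball_lorentz_neg (x : HypSpace n) {S : Set (UnitNormal n)} (hS : S.Finite)
    (h : ∀ e ∈ S, lorentz x.vec e.vec < 0) :
    ∃ ε > 0, ∀ y ∈ Metric.ball x ε, ∀ e ∈ S, lorentz y.vec e.vec < 0 := by
  have : ∀ᶠ y in 𝓝 x, ∀ e ∈ S, lorentz y.vec e.vec < 0 :=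
    (eventually_all_finite hS).2 fun e he =>
      ((continuous_lorentz e.vec).tendsto x).eventually_lt_const (h e he)
  exact Metric.eventually_nhds_iff_ball.1 this

end HypSpace

namespace UnitNormal

variable {n : ℕ}

theorem eq_of_vec_eq_smul {e f : UnitNormal n} {c : ℝ} (h : e.vec = c • f.vec) (p : HypSpace n)
    (hpe : lorentz p.vec e.vec < 0) (hpf : lorentz p.vec f.vec < 0) : e = f := by
  have h1 := e.lorentz_self
  rw [h, lorentz_smul_left, lorentz_smul_right, f.lorentz_self] at h1
  rw [h, lorentz_smul_right] at hpe
  have h2 : 0 < c := by nlinarith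
  have h3 : c = 1 := by nlinarith
  rw [h3, one_smul] at h
  exact UnitNormal.ext h

/-- Among finitely many half-spaces, finitely many suffice to cut out the same subset of the
subspace `w⊥`, each of which contributes a wall of this subset. -/
theorem exists_irredundant (w : Minkowski n) (A : Finset (UnitNormal n)) (z : HypSpace n)
    (hz : lorentz z.vec w = 0) (hA : ∀ e ∈ A, lorentz z.vec e.vec < 0) :
    ∃ B ⊆ A, (∀ x : HypSpace n, lorentz x.vec w = 0 → (∀ e ∈ B, lorentz x.vec e.vec ≤ 0) →
        ∀ e ∈ A, lorentz x.vec e.vec ≤ 0) ∧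
      ∀ e ∈ B, ∃ x : HypSpace n, lorentz x.vec w = 0 ∧ lorentz x.vec e.vec = 0 ∧
        ∃ ε > 0, ∀ y ∈ Metric.ball x ε, lorentz y.vec w = 0 → lorentz y.vec e.vec = 0 →
          ∀ e' ∈ A, lorentz y.vec e'.vec ≤ 0 := by
  classical
  -- The subfamilies cutting out the same set; one of least cardinality has no redundant member.
  let C : Finset (Finset (UnitNormal n)) := A.powerset.filter fun B =>
    ∀ x : HypSpace n, lorentz x.vec w = 0 → (∀ e ∈ B, lorentz x.vec e.vec ≤ 0) →
      ∀ e ∈ A, lorentz x.vec e.vec ≤ 0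
  obtain ⟨B, hB, hmin⟩ := C.exists_min_image Finset.card
    ⟨A, Finset.mem_filter.2 ⟨Finset.mem_powerset_self A, fun _ _ h => h⟩⟩
  obtain ⟨hBA, hB⟩ := Finset.mem_filter.1 hB
  rw [Finset.mem_powerset] at hBA
  refine ⟨B, hBA, hB, fun e he => ?_⟩
  have hne : B.erase e ∉ C := fun h =>
    absurd (hmin _ h) (not_le.2 (Finset.card_erase_lt_of_mem he))
  simp only [C, Finset.mem_filter, Finset.mem_powerset,
    (Finset.erase_subset e B).trans hBA, true_and] at hne
  push Not at hne
  obtain ⟨x, hxw, hxB, e', he', hxe'⟩ := hne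
  have hxe : 0 < lorentz x.vec e.vec := by
    by_contra hcon
    refine absurd (hB x hxw (fun f hf => ?_) e' he') (not_le.2 hxe')
    by_cases hfe : f = e
    · rw [hfe]; exact not_lt.1 hcon
    · exact hxB f (Finset.mem_erase.2 ⟨hfe, hf⟩)
  have hze := hA e (hBA he)
  -- Without `e` the point `x` becomes admissible, and it violates `e` alone within `B`. The segment
  -- from the strictly interior point `z` to `x` crosses the hyperplane of `e` at `u`, where the
  -- other constraints of `B` are still strict.
  obtain ⟨u, c, hc, hu⟩ := z.exists_vec_eq_smul_add x hxe (neg_nonneg.2 hze.le)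
  have hval : ∀ v, lorentz u.vec v =
      c * (lorentz x.vec e.vec * lorentz z.vec v + -lorentz z.vec e.vec * lorentz x.vec v) := by
    intro v
    rw [hu, lorentz_smul_left, lorentz_add_left, lorentz_smul_left, lorentz_smul_left]
  obtain ⟨ε, hε, hb⟩ := u.exists_ball_lorentz_neg (S := (B.erase e : Finset (UnitNormal n)))
    (Finset.finite_toSet _) (fun f hf => by
      rw [Finset.mem_coe] at hf
      rw [hval]
      have h1 := hA f (hBA (Finset.mem_of_mem_erase hf))
      have h2 := hxB f hf
      refine mul_neg_of_pos_of_neg hc ?_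
      nlinarith [mul_neg_of_pos_of_neg hxe h1])
  refine ⟨u, by rw [hval, hz, hxw]; ring, by rw [hval]; ring, ε, hε, fun y hy hyw hye => ?_⟩
  refine hB y hyw fun f hf => ?_
  by_cases hfe : f = e
  · rw [hfe, hye]
  · exact (hb y hy f (Finset.mem_coe.2 (Finset.mem_erase.2 ⟨hfe, hf⟩))).le

end UnitNormal

theorem Facet.normal_injective {n : ℕ} {P : Set (HypSpace n)} :
    Function.Injective (Facet.normal : Facet P → UnitNormal n) := fun _ _ h => Facet.ext h

/-- The normals of the facets occur in every description of `P` by finitely many half-spaces. -/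
theorem Facet.normal_mem {n : ℕ} {P : Set (HypSpace n)} {S : Set (UnitNormal n)} (hS : S.Finite)
    (hP : P = ⋂ e ∈ S, e.halfSpace) (hint : (interior P).Nonempty) (F : Facet P) :
    F.normal ∈ S := by
  obtain ⟨p, hp⟩ := hint
  obtain ⟨z, hz, ε, hε, hb⟩ := F.full
  have hPS : ∀ e ∈ S, P ⊆ e.halfSpace := fun e he => hP ▸ Set.biInter_subset_of_mem he
  have hzP : z ∈ P := hb ⟨Metric.mem_ball_self hε, hz⟩
  obtain ⟨e, he, hze⟩ : ∃ e ∈ S, lorentz z.vec e.vec = 0 := by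
    by_contra hcon
    push Not at hcon
    obtain ⟨δ, hδ, hball⟩ := z.exists_ball_lorentz_neg hS
      fun e he => lt_of_le_of_ne (hPS e he hzP) (hcon e he)
    have : z ∈ interior P := by
      rw [mem_interior_iff_mem_nhds, Metric.mem_nhds_iff]
      refine ⟨δ, hδ, fun y hy => ?_⟩
      rw [hP, Set.mem_iInter₂]
      exact fun e he => (hball y hy e he).le
    exact (HypSpace.lorentz_neg_of_mem_interior this _ F.subset_halfSpace).ne hz
  -- `e` is nowhere positive on a relative neighbourhood of `z` in the hyperplane of `F`, so it is
  -- proportional to the normal of `F`; the interior point `p` fixes the sign.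
  have h1 := z.eq_smul_of_nonpos_on_ball F.normal e.vec hz hze hε
    fun y hy hyf => hPS e he (hb ⟨hy, hyf⟩)
  rw [← UnitNormal.eq_of_vec_eq_smul h1 p
    (HypSpace.lorentz_neg_of_mem_interior hp _ (hPS e he))
    (HypSpace.lorentz_neg_of_mem_interior hp _ F.subset_halfSpace)]
  exact he

/-! ### Facets, adjacency and vertices of a right-angled polytope -/

namespace RightAngledPolytope

variable {n : ℕ} (P : RightAngledPolytope n)

instance : Finite (Facet P.carrier) := by
  obtain ⟨S, hS, hP⟩ := P.finite_halfSpaces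
  have := hS.to_subtype
  exact Finite.of_injective
    (fun F : Facet P.carrier => (⟨F.normal, F.normal_mem hS hP P.interior_nonempty⟩ : S))
    fun F G h => Facet.normal_injective (congrArg Subtype.val h)

/-- An interior point of `P`. -/
noncomputable def center : HypSpace n := P.interior_nonempty.some

theorem center_mem_interior : P.center ∈ interior P.carrier := P.interior_nonempty.some_mem

theorem center_mem : P.center ∈ P.carrier := interior_subset P.center_mem_interior

theorem lorentz_center_neg (F : Facet P.carrier) : lorentz P.center.vec F.normal.vec < 0 :=
  HypSpace.lorentz_neg_of_mem_interior P.center_mem_interior _ F.subset_halfSpace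

/-- The members of an irredundant family of half-spaces are facets. Taking `w = 0` in
`exists_irredundant` imposes no condition. -/
theorem mem_carrier_iff (x : HypSpace n) :
    x ∈ P.carrier ↔ ∀ F : Facet P.carrier, lorentz x.vec F.normal.vec ≤ 0 := by
  refine ⟨fun hx F => F.subset_halfSpace hx, fun hx => ?_⟩
  obtain ⟨S, hS, hP⟩ := P.finite_halfSpaces
  have hPS : ∀ e ∈ S, P.carrier ⊆ e.halfSpace := fun e he => by
    rw [hP]; exact Set.biInter_subset_of_mem he
  obtain ⟨B, hBA, hB, hfull⟩ := UnitNormal.exists_irredundant 0 hS.toFinset P.center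
    (lorentz_zero_right _) fun e he => HypSpace.lorentz_neg_of_mem_interior P.center_mem_interior _
      (hPS e (hS.mem_toFinset.1 he))
  have : x ∈ ⋂ e ∈ S, e.halfSpace := by
    rw [Set.mem_iInter₂]
    intro e he
    refine hB x (lorentz_zero_right _) (fun f hf => ?_) e (hS.mem_toFinset.2 he)
    obtain ⟨y, -, hy, ε, hε, hb⟩ := hfull f hf
    refine hx ⟨f, hPS f (hS.mem_toFinset.1 (hBA hf)), y, hy, ε, hε, fun u hu => ?_⟩
    rw [hP, Set.mem_iInter₂]
    exact fun e he => hb u hu.1 (lorentz_zero_right _) hu.2 e (hS.mem_toFinset.2 he)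
  rwa [hP]

variable {P}

theorem lorentz_eq_zero_of_adjacent {F G : Facet P.carrier} (h : F.Adjacent G) :
    lorentz F.normal.vec G.normal.vec = 0 := by
  have h1 := P.right_angled F G h
  rw [Facet.dihedralAngle, Real.arccos_eq_pi_div_two] at h1
  linarith

/-- A relative interior point of a facet lies on no other facet: a second normal vanishing there
would be proportional to the first. -/
theorem exists_mem_hyperplane_lorentz_neg (F : Facet P.carrier) :
    ∃ z ∈ F.normal.hyperplane, ∀ G : Facet P.carrier, G ≠ F →
      lorentz z.vec G.normal.vec < 0 := by
  obtain ⟨z, hz, ε, hε, hb⟩ := F.full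
  refine ⟨z, hz, fun G hG => lt_of_le_of_ne
    (G.subset_halfSpace (hb ⟨Metric.mem_ball_self hε, hz⟩)) fun h0 => hG ?_⟩
  have h1 := z.eq_smul_of_nonpos_on_ball F.normal G.normal.vec hz h0 hε
    fun y hy hyf => G.subset_halfSpace (hb ⟨hy, hyf⟩)
  exact Facet.normal_injective (UnitNormal.eq_of_vec_eq_smul h1 P.center
    (P.lorentz_center_neg G) (P.lorentz_center_neg F))

/-- A facet is cut out of its hyperplane by the adjacent facets. -/
theorem mem_carrier_of_adjacent (F : Facet P.carrier) {x : HypSpace n}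
    (hx : x ∈ F.normal.hyperplane)
    (h : ∀ G : Facet P.carrier, F.Adjacent G → lorentz x.vec G.normal.vec ≤ 0) :
    x ∈ P.carrier := by
  classical
  have := Fintype.ofFinite (Facet P.carrier)
  obtain ⟨z, hz, hneg⟩ := exists_mem_hyperplane_lorentz_neg F
  obtain ⟨B, hBA, hB, hfull⟩ := UnitNormal.exists_irredundant F.normal.vec
    ((Finset.univ.erase F).image Facet.normal) z hz (by
      intro e he
      obtain ⟨G, hG, rfl⟩ := Finset.mem_image.1 he
      exact hneg G (Finset.ne_of_mem_erase hG))
  have hmem : ∀ y : HypSpace n, lorentz y.vec F.normal.vec = 0 →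
      (∀ e ∈ (Finset.univ.erase F).image Facet.normal, lorentz y.vec e.vec ≤ 0) →
      y ∈ P.carrier := by
    intro y hy hye
    rw [mem_carrier_iff]
    intro G
    by_cases hGF : G = F
    · rw [hGF, hy]
    · exact hye _ (Finset.mem_image_of_mem _ (Finset.mem_erase.2 ⟨hGF, Finset.mem_univ _⟩))
  -- The irredundant half-spaces inside the hyperplane of `F` have walls of codimension two in `P`,
  -- so they come from facets adjacent to `F`.
  refine hmem x hx (hB x hx fun e he => ?_)
  obtain ⟨G, hG, rfl⟩ := Finset.mem_image.1 (hBA he)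
  obtain ⟨y, hyF, hyG, ε, hε, hb⟩ := hfull _ he
  exact h G ⟨(Finset.ne_of_mem_erase hG).symm, y, ⟨hyF, hyG⟩, ε, hε,
    fun u hu => hmem u hu.2.1 (hb u hu.1 hu.2.1 hu.2.2)⟩

/-- The projection of `P` to the hyperplane of a facet lies in `P`. -/
theorem lorentz_le_mul (F G : Facet P.carrier) {x : HypSpace n}
    (hx : x ∈ P.carrier) : lorentz x.vec G.normal.vec ≤
      lorentz x.vec F.normal.vec * lorentz F.normal.vec G.normal.vec := by
  obtain ⟨y, c, hc, hy⟩ := x.exists_vec_eq_smul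
    (x.vec - lorentz x.vec F.normal.vec • F.normal.vec)
    (by
      simp only [lorentz_sub_left, lorentz_sub_right, lorentz_smul_left, lorentz_smul_right,
        x.lorentz_self, F.normal.lorentz_self, lorentz_comm F.normal.vec x.vec]
      nlinarith [sq_nonneg (lorentz x.vec F.normal.vec)])
    (by
      simp only [lorentz_sub_right, lorentz_smul_right, x.lorentz_self]
      nlinarith [sq_nonneg (lorentz x.vec F.normal.vec)])
  have hval : ∀ v, lorentz y.vec v =
      c * (lorentz x.vec v - lorentz x.vec F.normal.vec * lorentz F.normal.vec v) := by
    intro v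
    rw [hy, lorentz_smul_left, lorentz_sub_left, lorentz_smul_left]
  -- The projection does not change the sign of the product with a normal orthogonal to that of `F`,
  -- and adjacent facets suffice to test membership.
  have hyP : y ∈ P.carrier := by
    refine mem_carrier_of_adjacent F ?_ fun K hK => ?_
    · change lorentz y.vec F.normal.vec = 0
      rw [hval, F.normal.lorentz_self]; ring
    · rw [hval, lorentz_eq_zero_of_adjacent hK]
      have := K.subset_halfSpace hx
      have : lorentz x.vec K.normal.vec ≤ 0 := this
      nlinarith
  have h1 : lorentz y.vec G.normal.vec ≤ 0 := G.subset_halfSpace hyP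
  rw [hval] at h1
  nlinarith

/-- The projection inequality `lorentz_le_mul` at a relative interior point `z` of `G` reads `0 ≤
⟨z, F⟩ ⟨F, G⟩` in terms of the normals, and `⟨z, F⟩ < 0`. -/
theorem lorentz_nonpos (F G : Facet P.carrier) (hFG : F ≠ G) :
    lorentz F.normal.vec G.normal.vec ≤ 0 := by
  obtain ⟨z, hz, hneg⟩ := exists_mem_hyperplane_lorentz_neg G
  have hzP : z ∈ P.carrier := by
    rw [mem_carrier_iff]
    intro K
    by_cases hK : K = G
    · rw [hK]; exact le_of_eq hz
    · exact (hneg K hK).le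
  have h1 := lorentz_le_mul F G hzP
  have h2 := hneg F hFG
  have h3 : lorentz z.vec G.normal.vec = 0 := hz
  rw [h3] at h1
  nlinarith

/-- The hyperplanes of two facets that are not adjacent do not intersect. -/
theorem adjacent_or_lorentz_le (F G : Facet P.carrier) (hFG : F ≠ G) :
    F.Adjacent G ∨ lorentz F.normal.vec G.normal.vec ≤ -1 := by
  by_contra hcon
  push Not at hcon
  obtain ⟨hadj, hlt⟩ := hcon
  apply hadj
  set c := lorentz F.normal.vec G.normal.vec with hc
  have hc0 : c ≤ 0 := lorentz_nonpos F G hFG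
  have hd : 0 < 1 - c ^ 2 := by nlinarith
  set p := P.center
  set a := -lorentz p.vec F.normal.vec with ha
  set b := -lorentz p.vec G.normal.vec with hb
  have ha0 : 0 < a := neg_pos.2 (P.lorentz_center_neg F)
  have hb0 : 0 < b := neg_pos.2 (P.lorentz_center_neg G)
  -- `1 - c ^ 2` times the orthogonal projection of the centre to both hyperplanes. From `-1 < c ≤
  -- 0` it is time-like with non-negative coefficients, so its products with all other normals stay
  -- negative: it points to a relative interior point of a common face of codimension two.
  set v := (1 - c ^ 2) • p.vec + (a - c * b) • F.normal.vec + (b - c * a) • G.normal.vec with hv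
  have hpF : lorentz p.vec F.normal.vec = -a := by rw [ha]; ring
  have hpG : lorentz p.vec G.normal.vec = -b := by rw [hb]; ring
  have hval : ∀ u, lorentz v u = (1 - c ^ 2) * lorentz p.vec u +
      (a - c * b) * lorentz F.normal.vec u + (b - c * a) * lorentz G.normal.vec u := by
    intro u
    simp only [hv, lorentz_add_left, lorentz_smul_left]
  have hvF : lorentz v F.normal.vec = 0 := by
    rw [hval, F.normal.lorentz_self, lorentz_comm G.normal.vec, ← hc, hpF]; ring
  have hvG : lorentz v G.normal.vec = 0 := by
    rw [hval, G.normal.lorentz_self, ← hc, hpG]; ring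
  have hpv : lorentz p.vec v < 0 := by
    rw [lorentz_comm, hval, p.lorentz_self, lorentz_comm F.normal.vec, lorentz_comm G.normal.vec,
      hpF, hpG]
    have h1 : 0 ≤ (a - c * b) * a := by
      refine mul_nonneg ?_ ha0.le; nlinarith
    have h2 : 0 ≤ (b - c * a) * b := by
      refine mul_nonneg ?_ hb0.le; nlinarith
    linarith
  have hvv : lorentz v v < 0 := by
    rw [hval, lorentz_comm F.normal.vec, lorentz_comm G.normal.vec, hvF, hvG]
    nlinarith
  obtain ⟨y, k, hk, hy⟩ := p.exists_vec_eq_smul v hvv hpv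
  have hyF : lorentz y.vec F.normal.vec = 0 := by rw [hy, lorentz_smul_left, hvF, mul_zero]
  have hyG : lorentz y.vec G.normal.vec = 0 := by rw [hy, lorentz_smul_left, hvG, mul_zero]
  have hyK : ∀ K : Facet P.carrier, K ≠ F → K ≠ G → lorentz y.vec K.normal.vec < 0 := by
    intro K hKF hKG
    rw [hy, lorentz_smul_left, hval]
    refine mul_neg_of_pos_of_neg hk ?_
    have h1 := mul_neg_of_pos_of_neg hd (P.lorentz_center_neg K)
    have h2 : (a - c * b) * lorentz F.normal.vec K.normal.vec ≤ 0 :=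
      mul_nonpos_of_nonneg_of_nonpos (by nlinarith) (lorentz_nonpos F K hKF.symm)
    have h3 : (b - c * a) * lorentz G.normal.vec K.normal.vec ≤ 0 :=
      mul_nonpos_of_nonneg_of_nonpos (by nlinarith) (lorentz_nonpos G K hKG.symm)
    exact add_neg_of_neg_of_nonpos (add_neg_of_neg_of_nonpos h1 h2) h3
  obtain ⟨ε, hε, hball⟩ := y.exists_ball_lorentz_neg
    (S := Facet.normal '' {K : Facet P.carrier | K ≠ F ∧ K ≠ G}) (Set.toFinite _) (by
      rintro _ ⟨K, hK, rfl⟩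
      exact hyK K hK.1 hK.2)
  refine ⟨hFG, y, ⟨hyF, hyG⟩, ε, hε, fun u hu => ?_⟩
  rw [mem_carrier_iff]
  intro K
  by_cases hKF : K = F
  · rw [hKF]; exact le_of_eq hu.2.1
  by_cases hKG : K = G
  · rw [hKG]; exact le_of_eq hu.2.2
  exact (hball u hu.1 _ ⟨K, ⟨hKF, hKG⟩, rfl⟩).le

/-- Facets with a common point are adjacent. -/
theorem adjacent_of_mem {F G : Facet P.carrier} (hFG : F ≠ G) {x : HypSpace n}
    (hF : x ∈ F.carrier) (hG : x ∈ G.carrier) : F.Adjacent G := by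
  refine (adjacent_or_lorentz_le F G hFG).resolve_right fun hle => ?_
  have hxF : lorentz x.vec F.normal.vec = 0 := hF.2
  have hxG : lorentz x.vec G.normal.vec = 0 := hG.2
  -- The sum of the normals is orthogonal to `x` but would have non-positive square, so it would be
  -- zero; yet its product with the centre is negative.
  have hx : lorentz x.vec (F.normal.vec + G.normal.vec) = 0 := by
    rw [lorentz_add_right, hxF, hxG, add_zero]
  have h1 := x.lorentz_self_nonneg _ hx
  have h2 : lorentz (F.normal.vec + G.normal.vec) (F.normal.vec + G.normal.vec) =
      2 + 2 * lorentz F.normal.vec G.normal.vec := by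
    simp only [lorentz_add_left, lorentz_add_right, F.normal.lorentz_self, G.normal.lorentz_self,
      lorentz_comm G.normal.vec F.normal.vec]
    ring
  have h3 := x.eq_zero_of_lorentz_self_eq_zero _ hx (by linarith)
  have h4 : lorentz P.center.vec (F.normal.vec + G.normal.vec) = 0 := by
    rw [h3, lorentz_zero_right]
  rw [lorentz_add_right] at h4
  linarith [P.lorentz_center_neg F, P.lorentz_center_neg G]

theorem lorentz_eq_zero_of_mem {F G : Facet P.carrier} (hFG : F ≠ G) {x : HypSpace n}
    (hF : x ∈ F.carrier) (hG : x ∈ G.carrier) : lorentz F.normal.vec G.normal.vec = 0 :=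
  lorentz_eq_zero_of_adjacent (adjacent_of_mem hFG hF hG)

/-- Every face of `P` has a vertex. -/
theorem exists_isVertex {x : HypSpace n} (hx : x ∈ P.carrier) :
    ∃ v, P.IsVertex v ∧ ∀ F : Facet P.carrier, x ∈ F.carrier → v ∈ F.carrier := by
  classical
  have := Fintype.ofFinite (Facet P.carrier)
  let N : HypSpace n → Finset (Facet P.carrier) := fun y => Finset.univ.filter (y ∈ ·.carrier)
  have hN : ∀ y F, F ∈ N y ↔ y ∈ F.carrier := fun y F => by simp [N]
  let C : Finset (Finset (Facet P.carrier)) :=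
    Finset.univ.filter fun A => N x ⊆ A ∧ ∃ y ∈ P.carrier, N y = A
  -- Among the points of the face of `x`, take one lying on as many facets as possible.
  obtain ⟨A, hA, hmax⟩ := C.exists_max_image Finset.card
    ⟨N x, Finset.mem_filter.2 ⟨Finset.mem_univ _, subset_rfl, x, hx, rfl⟩⟩
  obtain ⟨-, hxA, v, hv, rfl⟩ := Finset.mem_filter.1 hA
  refine ⟨v, ⟨hv, fun y hy hyF => ?_⟩, fun F hF => (hN v F).1 (hxA ((hN x F).2 hF))⟩
  by_contra hyv
  have hclosed : IsClosed {u : HypSpace n | ∀ F ∈ N v, lorentz u.vec F.normal.vec = 0} := by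
    simp only [Set.ofPred_forall]
    exact isClosed_biInter fun F _ =>
      isClosed_eq (HypSpace.continuous_lorentz _) continuous_const
  -- If the face of `v` had another point, take `z` in it farthest from `v`. By maximality `z` lies
  -- on the same facets as `v`, so the geodesic from `v` can be prolonged beyond `z` within the
  -- face, which is absurd.
  obtain ⟨z, ⟨hzP, hz⟩, hzmax⟩ := (P.isCompact.inter_right hclosed).exists_isMaxOn
    ⟨y, hy, fun F hF => (hyF F ((hN v F).1 hF)).2⟩
    (f := fun u => dist v u) (by fun_prop)
  have hvz : lorentz v.vec z.vec < -1 := by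
    have h1 : dist v y ≤ dist v z := hzmax ⟨hy, fun F hF => (hyF F ((hN v F).1 hF)).2⟩
    have h2 : 0 < dist v z := (dist_pos.2 (Ne.symm hyv)).trans_le h1
    have h3 := Real.one_lt_cosh.2 h2.ne'
    rw [HypSpace.cosh_dist] at h3
    linarith
  have hNz : N z = N v := by
    refine (Finset.eq_of_subset_of_card_le (fun F hF => (hN z F).2 ⟨hzP, hz F hF⟩)
      (hmax _ ?_)).symm
    exact Finset.mem_filter.2 ⟨Finset.mem_univ _,
      hxA.trans fun F hF => (hN z F).2 ⟨hzP, hz F hF⟩, z, hzP, rfl⟩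
  obtain ⟨ε, hε, hball⟩ := z.exists_ball_lorentz_neg
    (S := Facet.normal '' {K : Facet P.carrier | K ∉ N v}) (Set.toFinite _) (by
      rintro _ ⟨K, hK, rfl⟩
      refine lt_of_le_of_ne (K.subset_halfSpace hzP) fun h => hK ?_
      rw [← hNz]
      exact (hN z K).2 ⟨hzP, h⟩)
  -- The tangent vector at `z` that points away from `v`.
  have htan : lorentz z.vec (-lorentz v.vec z.vec • z.vec - v.vec) = 0 := by
    rw [lorentz_sub_right, lorentz_smul_right, z.lorentz_self, lorentz_comm z.vec]; ring
  obtain ⟨u, hu, c, hc, t, ht, huv⟩ := z.exists_mem_ball_vec_eq _ htan hε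
  have huN : ∀ F ∈ N v, lorentz u.vec F.normal.vec = 0 := by
    intro F hF
    have h1 : lorentz v.vec F.normal.vec = 0 := ((hN v F).1 hF).2
    simp only [huv, lorentz_add_left, lorentz_sub_left, lorentz_smul_left, hz F hF, h1]
    ring
  have huP : u ∈ P.carrier := by
    rw [mem_carrier_iff]
    intro K
    by_cases hK : K ∈ N v
    · exact (huN K hK).le
    · exact (hball u hu _ ⟨K, hK, rfl⟩).le
  have h1 : dist v u ≤ dist v z := hzmax ⟨huP, huN⟩
  rw [← not_lt, HypSpace.dist_lt_dist_iff] at h1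
  apply h1
  set w := lorentz v.vec z.vec with hw
  have hself := u.lorentz_self
  have hwz : lorentz z.vec v.vec = w := by rw [lorentz_comm]
  rw [huv] at hself
  simp only [lorentz_add_left, lorentz_sub_left, lorentz_smul_left, lorentz_add_right,
    lorentz_sub_right, lorentz_smul_right, z.lorentz_self, v.lorentz_self, hwz, ← hw] at hself
  simp only [huv, lorentz_add_right, lorentz_sub_right, lorentz_smul_right, ← hw,
    v.lorentz_self]
  have hc1 : 1 < c := by
    have : 0 < t ^ 2 * (w ^ 2 - 1) := mul_pos (by positivity) (by nlinarith)
    nlinarith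
  nlinarith [mul_pos ht (by nlinarith : 0 < w ^ 2 - 1)]

end RightAngledPolytope

/-! ### Word length in `Γ`, and `P` as a strict fundamental domain -/

namespace RightAngledPolytope

variable {n : ℕ} (P : RightAngledPolytope n)

/-- The generator `r_F` of the Coxeter group. -/
def gen (F : Facet P.carrier) : P.coxeterGroup := PresentedGroup.of F

theorem smul_def (g : P.coxeterGroup) (x : HypSpace n) : g • x = P.reflectionHom g x := rfl

theorem gen_smul (F : Facet P.carrier) (x : HypSpace n) :
    P.gen F • x = F.normal.reflection x := by
  rw [smul_def, gen, reflectionHom, PresentedGroup.toGroup.of]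

theorem lorentz_gen_smul (F : Facet P.carrier) (x : HypSpace n) (w : Minkowski n) :
    lorentz (P.gen F • x).vec w =
      lorentz x.vec w - 2 * lorentz x.vec F.normal.vec * lorentz F.normal.vec w := by
  rw [gen_smul]
  change lorentz (F.normal.reflectVec x.vec) w = _
  rw [UnitNormal.reflectVec, lorentz_sub_left, lorentz_smul_left]

theorem gen_smul_eq_self {F : Facet P.carrier} {x : HypSpace n}
    (h : lorentz x.vec F.normal.vec = 0) : P.gen F • x = x := by
  apply HypSpace.ext
  rw [gen_smul]
  change F.normal.reflectVec x.vec = _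
  rw [UnitNormal.reflectVec, h, mul_zero, zero_smul, sub_zero]

theorem gen_mul_gen (F : Facet P.carrier) : P.gen F * P.gen F = 1 := by
  have h : PresentedGroup.mk P.relators (FreeGroup.of F ^ 2) = 1 :=
    PresentedGroup.one_of_mem (Or.inl ⟨F, rfl⟩)
  rw [map_pow, pow_two] at h
  exact h

theorem gen_mul_gen_mul (F : Facet P.carrier) (g : P.coxeterGroup) :
    P.gen F * (P.gen F * g) = g := by
  rw [← mul_assoc, gen_mul_gen, one_mul]

theorem gen_inv (F : Facet P.carrier) : (P.gen F)⁻¹ = P.gen F :=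
  inv_eq_of_mul_eq_one_left (P.gen_mul_gen F)

variable {P} in
theorem gen_mul_comm {F G : Facet P.carrier} (h : F.Adjacent G) :
    P.gen F * P.gen G = P.gen G * P.gen F := by
  have h1 : PresentedGroup.mk P.relators
      (FreeGroup.of F * FreeGroup.of G * (FreeGroup.of F)⁻¹ * (FreeGroup.of G)⁻¹) = 1 :=
    PresentedGroup.one_of_mem (Or.inr ⟨F, G, h, rfl⟩)
  rw [map_mul, map_mul, map_mul, map_inv, map_inv, mul_inv_eq_one, mul_inv_eq_iff_eq_mul] at h1
  exact h1

theorem closure_range_gen : Subgroup.closure (Set.range P.gen) = ⊤ :=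
  PresentedGroup.closure_range_of P.relators

theorem exists_list_prod (g : P.coxeterGroup) :
    ∃ k, ∃ l : List (Facet P.carrier), l.length = k ∧ (l.map P.gen).prod = g := by
  have hg : g ∈ Subgroup.closure (Set.range P.gen) := by
    rw [closure_range_gen]; trivial
  induction hg using Subgroup.closure_induction with
  | mem x hx =>
    obtain ⟨F, rfl⟩ := hx
    exact ⟨1, [F], rfl, by simp⟩
  | one => exact ⟨0, [], rfl, by simp⟩
  | mul x y _ _ hx hy =>
    obtain ⟨-, l, -, rfl⟩ := hx
    obtain ⟨-, l', -, rfl⟩ := hy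
    exact ⟨_, l ++ l', rfl, by simp⟩
  | inv x _ hx =>
    obtain ⟨-, l, -, rfl⟩ := hx
    refine ⟨_, l.reverse, rfl, ?_⟩
    rw [List.prod_inv_reverse, List.map_reverse, List.map_map]
    congr 3
    funext F
    exact (P.gen_inv F).symm

open Classical in
/-- The word length of an element of the Coxeter group. -/
noncomputable def wordLength (g : P.coxeterGroup) : ℕ := Nat.find (P.exists_list_prod g)

open Classical in
theorem exists_list_length_eq (g : P.coxeterGroup) :
    ∃ l : List (Facet P.carrier), l.length = P.wordLength g ∧ (l.map P.gen).prod = g :=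
  Nat.find_spec (P.exists_list_prod g)

open Classical in
theorem wordLength_le (l : List (Facet P.carrier)) :
    P.wordLength (l.map P.gen).prod ≤ l.length :=
  Nat.find_min' _ ⟨l, rfl, rfl⟩

theorem wordLength_gen_mul_le (F : Facet P.carrier) (g : P.coxeterGroup) :
    P.wordLength (P.gen F * g) ≤ P.wordLength g + 1 := by
  obtain ⟨l, hl, rfl⟩ := P.exists_list_length_eq g
  have := P.wordLength_le (F :: l)
  rw [List.map_cons, List.prod_cons, List.length_cons] at this
  omega

/-- The parity of the word length. -/
def parity : P.coxeterGroup →* Multiplicative (ZMod 2) :=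
  PresentedGroup.toGroup (f := fun _ => Multiplicative.ofAdd (1 : ZMod 2)) (by
    rintro w (⟨F, rfl⟩ | ⟨F, G, -, rfl⟩)
    · rw [map_pow, FreeGroup.lift_apply_of]; decide
    · simp only [map_mul, map_inv, FreeGroup.lift_apply_of]; decide)

theorem parity_eq (g : P.coxeterGroup) :
    P.parity g = Multiplicative.ofAdd (P.wordLength g : ZMod 2) := by
  obtain ⟨l, hl, hg⟩ := P.exists_list_length_eq g
  rw [← hl]
  conv_lhs => rw [← hg]
  clear hl hg
  induction l with
  | nil => simp
  | cons F l ih =>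
    have h1 : P.parity (P.gen F) = Multiplicative.ofAdd 1 := PresentedGroup.toGroup.of _
    rw [List.map_cons, List.prod_cons, map_mul, ih, h1, List.length_cons, Nat.cast_add,
      Nat.cast_one, ← ofAdd_add, add_comm]

/-- All relators have even length, so multiplying by a generator changes the parity and the lengths
cannot agree. -/
theorem wordLength_gen_mul (F : Facet P.carrier) (g : P.coxeterGroup) :
    P.wordLength (P.gen F * g) = P.wordLength g + 1 ∨
      P.wordLength (P.gen F * g) + 1 = P.wordLength g := by
  have h1 := P.wordLength_gen_mul_le F g
  have h2 := P.wordLength_gen_mul_le F (P.gen F * g)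
  rw [gen_mul_gen_mul] at h2
  have h3 : P.wordLength (P.gen F * g) ≠ P.wordLength g := by
    intro h
    have h4 := P.parity_eq (P.gen F * g)
    have h5 : P.parity (P.gen F) = Multiplicative.ofAdd 1 := PresentedGroup.toGroup.of _
    rw [h, ← parity_eq, map_mul, mul_eq_right, h5] at h4
    exact absurd h4 (by decide)
  omega

theorem exists_wordLength_gen_mul_lt {g : P.coxeterGroup} (hg : g ≠ 1) :
    ∃ F, P.wordLength (P.gen F * g) < P.wordLength g := by
  obtain ⟨l, hl, hlg⟩ := P.exists_list_length_eq g
  cases l with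
  | nil => exact absurd hlg.symm (by simpa using hg)
  | cons F l =>
    refine ⟨F, ?_⟩
    rw [List.map_cons, List.prod_cons] at hlg
    have := P.wordLength_le l
    rw [← P.gen_mul_gen_mul F (l.map P.gen).prod, hlg] at this
    rw [List.length_cons] at hl
    omega

theorem wordLength_one : P.wordLength 1 = 0 := by
  have := P.wordLength_le []
  simpa using this

/-- The translate `g P` lies on one side of the hyperplane of each facet of `P`, as determined by
the word length. -/
theorem lorentz_smul_nonpos_aux (k : ℕ) : ∀ g : P.coxeterGroup, P.wordLength g = k →
    (∀ F, k < P.wordLength (P.gen F * g) →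
      ∀ x ∈ P.carrier, lorentz (g • x).vec F.normal.vec ≤ 0) ∧
    (∀ F G : Facet P.carrier, lorentz F.normal.vec G.normal.vec ≤ -1 →
      k < P.wordLength (P.gen F * g) → P.wordLength (P.gen G * g) < k →
      ∀ x ∈ P.carrier, lorentz (g • x).vec F.normal.vec + lorentz (g • x).vec G.normal.vec ≤ 0) := by
  induction k with
  | zero =>
    intro g hg
    obtain rfl : g = 1 := by
      by_contra h
      obtain ⟨F, hF⟩ := P.exists_wordLength_gen_mul_lt h
      omega
    refine ⟨fun F _ x hx => ?_, fun F G _ _ h => absurd h (Nat.not_lt_zero _)⟩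
    rw [one_smul]
    exact F.subset_halfSpace hx
  | succ k ih =>
    intro g hg
    -- If `r_G` shortens `g`, write `g = r_G h`; the products of `g • x` are computed from those of
    -- `h • x`, to which the induction hypothesis applies.
    have key : ∀ G : Facet P.carrier, P.wordLength (P.gen G * g) < k + 1 →
        P.wordLength (P.gen G * g) = k ∧ ∀ x ∈ P.carrier,
          lorentz ((P.gen G * g) • x).vec G.normal.vec ≤ 0 ∧
          ∀ w, lorentz (g • x).vec w = lorentz ((P.gen G * g) • x).vec w -
            2 * lorentz ((P.gen G * g) • x).vec G.normal.vec * lorentz G.normal.vec w := by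
      intro G hG
      have hk : P.wordLength (P.gen G * g) = k := by
        have := P.wordLength_gen_mul G g
        omega
      refine ⟨hk, fun x hx => ⟨(ih _ hk).1 G (by rw [gen_mul_gen_mul]; omega) x hx, fun w => ?_⟩⟩
      rw [← P.lorentz_gen_smul, ← mul_smul, gen_mul_gen_mul]
    -- Let `α`, `β` be the products of `h • x` with the normals of `F`, `G`, and `c ≤ -1` that of
    -- the normals. The sum is `α - (2c + 1) β ≤ α + β` since `β ≤ 0`. If `r_F` lengthens `h` then
    -- `α ≤ 0`; if not, the second clause for `h`, with `F` and `G` exchanged, gives `α + β ≤ 0`.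
    have hb : ∀ F G : Facet P.carrier, lorentz F.normal.vec G.normal.vec ≤ -1 →
        k + 1 < P.wordLength (P.gen F * g) → P.wordLength (P.gen G * g) < k + 1 →
        ∀ x ∈ P.carrier,
          lorentz (g • x).vec F.normal.vec + lorentz (g • x).vec G.normal.vec ≤ 0 := by
      intro F G hFG hF hG x hx
      obtain ⟨hk, hkey⟩ := key G hG
      obtain ⟨hneg, hval⟩ := hkey x hx
      rw [hval, hval, G.normal.lorentz_self, lorentz_comm G.normal.vec]
      rcases P.wordLength_gen_mul F (P.gen G * g) with h | h
      · have h1 := (ih _ hk).1 F (by omega) x hx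
        nlinarith
      · have h1 := (ih _ hk).2 G F (by rwa [lorentz_comm]) (by rw [gen_mul_gen_mul]; omega)
          (by omega) x hx
        nlinarith
    refine ⟨fun F hF x hx => ?_, hb⟩
    obtain ⟨G, hG⟩ := P.exists_wordLength_gen_mul_lt (g := g) (by
      rintro rfl; rw [wordLength_one] at hg; omega)
    rw [hg] at hG
    have hFG : F ≠ G := by rintro rfl; omega
    obtain ⟨hk, hkey⟩ := key G hG
    obtain ⟨hneg, hval⟩ := hkey x hx
    -- In the adjacent case `r_G` does not affect the product with the normal of `F`, and `r_F`
    -- lengthens `h` because it commutes with `r_G`. Otherwise the bound on the sum suffices, the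
    -- product with the normal of `G` being non-negative.
    rcases adjacent_or_lorentz_le F G hFG with hadj | hle
    · rw [hval, lorentz_comm G.normal.vec, lorentz_eq_zero_of_adjacent hadj, mul_zero, sub_zero]
      refine (ih _ hk).1 F ?_ x hx
      have h1 : P.gen G * (P.gen F * (P.gen G * g)) = P.gen F * g := by
        rw [← mul_assoc (P.gen F), gen_mul_comm hadj, mul_assoc, gen_mul_gen_mul]
      have h2 := P.wordLength_gen_mul_le G (P.gen F * (P.gen G * g))
      have h3 := P.wordLength_gen_mul F (P.gen G * g)
      rw [h1] at h2
      omega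
    · have h1 := hb F G hle hF hG x hx
      have h2 := hval G.normal.vec
      rw [G.normal.lorentz_self] at h2
      linarith

theorem lorentz_smul_nonneg {g : P.coxeterGroup} {F : Facet P.carrier}
    (h : P.wordLength (P.gen F * g) < P.wordLength g) {x : HypSpace n} (hx : x ∈ P.carrier) :
    0 ≤ lorentz (g • x).vec F.normal.vec := by
  have h1 := (P.lorentz_smul_nonpos_aux _ (P.gen F * g) rfl).1 F
    (by rwa [gen_mul_gen_mul]) x hx
  rw [mul_smul, lorentz_gen_smul, F.normal.lorentz_self] at h1
  linarith

/-- `P` is a strict fundamental domain, with stabilizers generated by the reflections in facets. -/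
theorem smul_eq_and_mem_closure {x : HypSpace n} (hx : x ∈ P.carrier) (g : P.coxeterGroup)
    (hg : g • x ∈ P.carrier) :
    g • x = x ∧ g ∈ Subgroup.closure (P.gen '' {F | x ∈ F.carrier}) := by
  induction hk : P.wordLength g generalizing g with
  | zero =>
    obtain rfl : g = 1 := by
      by_contra h
      obtain ⟨F, hF⟩ := P.exists_wordLength_gen_mul_lt h
      omega
    exact ⟨one_smul _ _, one_mem _⟩
  | succ k ih =>
    obtain ⟨F, hF⟩ := P.exists_wordLength_gen_mul_lt (g := g) (by
      rintro rfl; rw [wordLength_one] at hk; omega)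
    -- Since `r_F` shortens `g`, the translate `g P` lies beyond `F`; so `g • x` lies on `F`, is
    -- fixed by `r_F`, and the shorter element `r_F g` also takes `x` there.
    have h0 : lorentz (g • x).vec F.normal.vec = 0 :=
      le_antisymm (F.subset_halfSpace hg) (P.lorentz_smul_nonneg hF hx)
    have h1 : (P.gen F * g) • x = g • x := by
      rw [mul_smul, P.gen_smul_eq_self h0]
    obtain ⟨h2, h3⟩ := ih (P.gen F * g) (by rwa [h1]) (by
      have := P.wordLength_gen_mul F g
      omega)
    rw [h1] at h2
    refine ⟨h2, ?_⟩
    rw [← P.gen_mul_gen_mul F g]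
    refine mul_mem (Subgroup.subset_closure ⟨F, ⟨hx, ?_⟩, rfl⟩) h3
    rwa [h2] at h0

theorem smul_eq_of_mem {x y : HypSpace n} (hx : x ∈ P.carrier) (hy : y ∈ P.carrier)
    (g : P.coxeterGroup) (h : g • x = y) : x = y := by
  rw [← h, (P.smul_eq_and_mem_closure hx g (h ▸ hy)).1]

theorem eq_one_of_smul_center_mem (g : P.coxeterGroup) (hg : g • P.center ∈ P.carrier) :
    g = 1 := by
  have h := (P.smul_eq_and_mem_closure P.center_mem g hg).2
  have h0 : {F : Facet P.carrier | P.center ∈ F.carrier} = ∅ := by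
    ext F
    simp only [Set.mem_ofPred_eq, Set.mem_empty_iff_false, iff_false]
    exact fun hF => (P.lorentz_center_neg F).ne hF.2
  rwa [h0, Set.image_empty, Subgroup.closure_empty, Subgroup.mem_bot] at h

/-- The action of the Coxeter group is properly discontinuous. -/
theorem finite_dist_smul_le (x y : HypSpace n) (R : ℝ) :
    {g : P.coxeterGroup | dist x (g • y) ≤ R}.Finite := by
  set p := P.center with hp
  obtain ⟨δ, hδ, hball⟩ := Metric.mem_nhds_iff.1 (mem_interior_iff_mem_nhds.1 P.center_mem_interior)
  -- The translates of the centre are uniformly separated, so only finitely many lie in a compact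
  -- ball.
  have hsep : ∀ g h : P.coxeterGroup, dist (g • p) (h • p) < δ → g = h := by
    intro g h hgh
    rw [← dist_smul g⁻¹, inv_smul_smul, ← mul_smul, dist_comm] at hgh
    exact inv_mul_eq_one.1 (P.eq_one_of_smul_center_mem _ (hball hgh))
  obtain ⟨t, ht, hcov⟩ := Metric.totallyBounded_iff.1
    (isCompact_closedBall x (R + dist y p)).totallyBounded (δ / 2) (by positivity)
  have : ∀ g ∈ {g : P.coxeterGroup | dist x (g • y) ≤ R}, ∃ c ∈ t, dist (g • p) c < δ / 2 := by
    intro g hg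
    have h1 : g • p ∈ Metric.closedBall x (R + dist y p) := by
      rw [Metric.mem_closedBall, dist_comm]
      refine (dist_triangle x (g • y) _).trans ?_
      rw [dist_smul]
      exact add_le_add_left hg _
    simpa using hcov h1
  have hne : Nonempty (HypSpace n) := ⟨x⟩
  choose! c hct hc using this
  refine Set.Finite.of_injOn hct (fun g hg h hh hgh => hsep g h ?_) ht
  have h1 := hc g hg
  have h2 := hc h hh
  rw [hgh] at h1
  rw [dist_comm] at h2
  linarith [dist_triangle (g • p) (c h) (h • p)]

/-- The translates of `P` cover hyperbolic space. -/
theorem exists_smul_mem (x : HypSpace n) : ∃ g : P.coxeterGroup, g • x ∈ P.carrier := by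
  -- A translate of `x` nearest to the centre lies in `P`: beyond a facet, reflecting it would bring
  -- it nearer.
  obtain ⟨g, hg, hmin⟩ := Set.exists_min_image _ (fun g : P.coxeterGroup => dist P.center (g • x))
    (P.finite_dist_smul_le P.center x (dist P.center x)) ⟨1, by simp⟩
  refine ⟨g, (P.mem_carrier_iff _).2 fun F => ?_⟩
  by_contra! hpos
  have hlt : dist P.center ((P.gen F * g) • x) < dist P.center (g • x) := by
    rw [HypSpace.dist_lt_dist_iff, lorentz_comm, lorentz_comm P.center.vec, mul_smul,
      lorentz_gen_smul, lorentz_comm F.normal.vec]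
    nlinarith [mul_pos_of_neg_of_neg (P.lorentz_center_neg F) (neg_lt_zero.2 hpos)]
  exact absurd (hmin _ (hlt.le.trans hg)) (not_le.2 hlt)

end RightAngledPolytope

/-! ### Freeness of the action of `Γ_λ` -/

namespace Colouring

variable {n : ℕ} {P : RightAngledPolytope n} {V : Type*} [AddCommGroup V] [Module (ZMod 2) V]
  (col : Colouring P V)

theorem hom_gen (F : Facet P.carrier) :
    col.hom (P.gen F) = Multiplicative.ofAdd (col.colour F) :=
  PresentedGroup.toGroup.of _

/-- The face containing `x` has a vertex, and all facets through `x` pass through it. -/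
theorem linearIndependent_of_mem {x : HypSpace n} (hx : x ∈ P.carrier) :
    LinearIndependent (ZMod 2)
      (fun F : {F : Facet P.carrier // x ∈ F.carrier} => col.colour F.1) := by
  obtain ⟨v, hv, hxv⟩ := P.exists_isVertex hx
  exact (col.linearIndependent v hv).comp
    (fun F : {F : Facet P.carrier // x ∈ F.carrier} => ⟨F.1, hxv F.1 F.2⟩)
    fun F G h => Subtype.ext (congrArg (fun K => K.1) h)

/-- A coordinate functional of the independent colours at `x`, used to count the parity of `r_F` in
elements of the stabilizer. -/
theorem exists_dual {x : HypSpace n} (hx : x ∈ P.carrier) {F : Facet P.carrier}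
    (hF : x ∈ F.carrier) : ∃ f : V →ₗ[ZMod 2] ZMod 2, f (col.colour F) = 1 ∧
      ∀ G : Facet P.carrier, x ∈ G.carrier → G ≠ F → f (col.colour G) = 0 := by
  classical
  have hli := col.linearIndependent_of_mem hx
  obtain ⟨f, hf⟩ := LinearMap.exists_extend ((Finsupp.lapply (⟨F, hF⟩ :
    {F : Facet P.carrier // x ∈ F.carrier})).comp hli.repr)
  have hval : ∀ G : {F : Facet P.carrier // x ∈ F.carrier},
      f (col.colour G.1) = Finsupp.single G (1 : ZMod 2) ⟨F, hF⟩ := by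
    intro G
    have h1 := LinearMap.congr_fun hf ⟨col.colour G.1, Submodule.subset_span (Set.mem_range_self G)⟩
    rw [LinearMap.comp_apply, Submodule.subtype_apply] at h1
    rw [h1, LinearMap.comp_apply, hli.repr_eq_single G _ rfl,
      Finsupp.lapply_apply]
  refine ⟨f, ?_, fun G hG hne => ?_⟩
  · rw [hval ⟨F, hF⟩, Finsupp.single_eq_same]
  · rw [hval ⟨G, hG⟩, Finsupp.single_eq_of_ne]
    exact fun h => hne (congrArg Subtype.val h).symm

/-- An element of the stabilizer of a point `x` of `P` reflects the normals of the facets through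
`x` according to its colour. -/
theorem lorentz_smul_of_mem_closure {x : HypSpace n} {F : Facet P.carrier}
    (hF : x ∈ F.carrier) (f : V →ₗ[ZMod 2] ZMod 2) (hf : f (col.colour F) = 1)
    (hf' : ∀ G : Facet P.carrier, x ∈ G.carrier → G ≠ F → f (col.colour G) = 0)
    {g : P.coxeterGroup} (hg : g ∈ Subgroup.closure (P.gen '' {F | x ∈ F.carrier})) :
    (f (col.hom g).toAdd = 0 ∧
      ∀ y : HypSpace n, lorentz (g • y).vec F.normal.vec = lorentz y.vec F.normal.vec) ∨
    (f (col.hom g).toAdd = 1 ∧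
      ∀ y : HypSpace n, lorentz (g • y).vec F.normal.vec = -lorentz y.vec F.normal.vec) := by
  induction hg using Subgroup.closure_induction with
  | mem g hg =>
    obtain ⟨G, hG, rfl⟩ := hg
    rw [hom_gen, toAdd_ofAdd]
    by_cases hGF : G = F
    · subst hGF
      refine Or.inr ⟨hf, fun y => ?_⟩
      rw [P.lorentz_gen_smul, G.normal.lorentz_self]; ring
    · refine Or.inl ⟨hf' G hG hGF, fun y => ?_⟩
      rw [P.lorentz_gen_smul, RightAngledPolytope.lorentz_eq_zero_of_mem hGF hG hF]; ring
  | one => exact Or.inl ⟨by simp, fun y => by rw [one_smul]⟩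
  | mul a b _ _ ha hb =>
    simp only [map_mul, toAdd_mul, map_add, mul_smul]
    rcases ha with ⟨ha, ha'⟩ | ⟨ha, ha'⟩ <;> rcases hb with ⟨hb, hb'⟩ | ⟨hb, hb'⟩ <;>
      simp only [ha, hb, ha', hb', neg_neg]
    · exact Or.inl ⟨by decide, fun _ => trivial⟩
    · exact Or.inr ⟨by decide, fun _ => trivial⟩
    · exact Or.inr ⟨by decide, fun _ => trivial⟩
    · exact Or.inl ⟨by decide, fun _ => trivial⟩
  | inv a _ ha =>
    simp only [map_inv, toAdd_inv, map_neg]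
    rcases ha with ⟨ha, ha'⟩ | ⟨ha, ha'⟩
    · refine Or.inl ⟨by rw [ha, neg_zero], fun y => ?_⟩
      rw [← ha', smul_inv_smul]
    · refine Or.inr ⟨by rw [ha]; decide, fun y => ?_⟩
      rw [eq_neg_iff_add_eq_zero, ← neg_eq_iff_add_eq_zero, ← ha', smul_inv_smul]

/-- If `g ≠ 1`, some `r_F` shortens it; then `F` passes through the fixed point `x` and `g P` lies
beyond `F`. So `g` changes the sign of the product of the centre with the normal of `F`, which an
element of trivial colour in the stabilizer of `x` cannot do. -/
theorem eq_one_of_smul_mem {x : HypSpace n} (hx : x ∈ P.carrier) {g : P.coxeterGroup}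
    (hg : g ∈ col.kernel) (hgx : g • x ∈ P.carrier) : g = 1 := by
  by_contra hne
  obtain ⟨hfix, hcl⟩ := P.smul_eq_and_mem_closure hx g hgx
  obtain ⟨F, hF⟩ := P.exists_wordLength_gen_mul_lt hne
  have hxF : x ∈ F.carrier := by
    refine ⟨hx, le_antisymm (F.subset_halfSpace hx) ?_⟩
    have := P.lorentz_smul_nonneg hF hx
    rwa [hfix] at this
  obtain ⟨f, hf, hf'⟩ := col.exists_dual hx hxF
  have h0 := P.lorentz_smul_nonneg hF P.center_mem
  have h1 := P.lorentz_center_neg F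
  rcases col.lorentz_smul_of_mem_closure hxF f hf hf' hcl with ⟨-, h⟩ | ⟨h, -⟩
  · rw [h] at h0; linarith
  · rw [MonoidHom.mem_ker.1 hg, toAdd_one, map_zero] at h
    exact absurd h (by decide)

/-- `Γ_λ` acts freely. -/
theorem eq_one_of_smul_eq {x : HypSpace n} {g : P.coxeterGroup} (hg : g ∈ col.kernel)
    (hgx : g • x = x) : g = 1 := by
  obtain ⟨h, hh⟩ := P.exists_smul_mem x
  have h1 : h * g * h⁻¹ = 1 := by
    refine col.eq_one_of_smul_mem hh ((MonoidHom.normal_ker col.hom).conj_mem g hg h) ?_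
    rwa [mul_smul, mul_smul, inv_smul_smul, hgx]
  rwa [mul_inv_eq_one, mul_eq_left] at h1

end Colouring

/-! ### Local isometries, the folding map and the quotient manifolds -/

open Topology Filter in
/-- A map that preserves distances on a ball and maps it onto a ball has a local inverse. -/
noncomputable def OpenPartialHomeomorph.ofIsometryOnBall {X M : Type*} [MetricSpace X]
    [PseudoMetricSpace M] [Nonempty X] (f : X → M) (x : X) (r : ℝ)
    (hf : ∀ y ∈ Metric.ball x r, ∀ z ∈ Metric.ball x r, dist (f y) (f z) = dist y z)
    (himage : f '' Metric.ball x r = Metric.ball (f x) r) : OpenPartialHomeomorph M X where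
  toFun := Function.invFunOn f (Metric.ball x r)
  invFun := f
  source := Metric.ball (f x) r
  target := Metric.ball x r
  map_source' q hq := by
    rw [← himage] at hq
    exact Function.invFunOn_mem hq
  map_target' y hy := himage ▸ Set.mem_image_of_mem f hy
  left_inv' q hq := by
    rw [← himage] at hq
    exact Function.invFunOn_eq hq
  right_inv' y hy := by
    have hy' : ∃ z ∈ Metric.ball x r, f z = f y := ⟨y, hy, rfl⟩
    have h := hf _ (Function.invFunOn_mem hy') y hy
    rw [Function.invFunOn_eq hy', dist_self] at h
    exact dist_eq_zero.1 h.symm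
  open_source := Metric.isOpen_ball
  open_target := Metric.isOpen_ball
  continuousOn_toFun := by
    rw [Metric.continuousOn_iff]
    intro q hq ε hε
    refine ⟨ε, hε, fun p hp hpq => ?_⟩
    rw [← himage] at hp hq
    rwa [← hf _ (Function.invFunOn_mem hp) _ (Function.invFunOn_mem hq),
      Function.invFunOn_eq hp, Function.invFunOn_eq hq]
  continuousOn_invFun := by
    rw [Metric.continuousOn_iff]
    intro y hy ε hε
    refine ⟨ε, hε, fun z hz hzy => ?_⟩
    rwa [hf z hz y hy]

namespace OpenPartialHomeomorph

variable {X M : Type*} [MetricSpace X] [PseudoMetricSpace M] [Nonempty X] {f : X → M} {x : X}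
  {r : ℝ} (hf : ∀ y ∈ Metric.ball x r, ∀ z ∈ Metric.ball x r, dist (f y) (f z) = dist y z)
  (himage : f '' Metric.ball x r = Metric.ball (f x) r)

theorem ofIsometryOnBall_apply {y : X} (hy : y ∈ Metric.ball x r) :
    ofIsometryOnBall f x r hf himage (f y) = y :=
  (ofIsometryOnBall f x r hf himage).right_inv hy

theorem ofIsometryOnBall_dist {p q : M} (hp : p ∈ Metric.ball (f x) r)
    (hq : q ∈ Metric.ball (f x) r) :
    dist (ofIsometryOnBall f x r hf himage p) (ofIsometryOnBall f x r hf himage q) =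
      dist p q := by
  rw [← himage] at hp hq
  obtain ⟨y, hy, rfl⟩ := hp
  obtain ⟨z, hz, rfl⟩ := hq
  rw [ofIsometryOnBall_apply hf himage hy, ofIsometryOnBall_apply hf himage hz, hf y hy z hz]

end OpenPartialHomeomorph

instance {n : ℕ} : Nonempty (HypSpace n) := ⟨HypSpace.origin n⟩

namespace RightAngledPolytope

open Topology Filter

variable {n : ℕ} (P : RightAngledPolytope n)

/-- The translates of a compact set are a locally finite family. -/
theorem exists_ball_mem_smul {K : Set (HypSpace n)} (hK : IsCompact K) (x : HypSpace n) :
    ∃ r > 0, ∀ (g : P.coxeterGroup), ∀ y ∈ K, dist x (g • y) < r → ∃ y' ∈ K, g • y' = x := by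
  obtain ⟨R, hR⟩ := hK.isBounded.subset_closedBall P.center
  -- Only these finitely many `g` have a translate of `K` within distance `1` of `x`; each translate
  -- is closed, so one that misses `x` misses a neighbourhood.
  have h1 : ∀ᶠ z in 𝓝 x, ∀ g ∈ {g : P.coxeterGroup | dist x (g • P.center) ≤ 1 + R},
      (¬∃ y' ∈ K, g • y' = x) → ¬∃ y' ∈ K, g • y' = z := by
    refine (eventually_all_finite (P.finite_dist_smul_le _ _ _)).2 fun g _ => ?_
    by_cases hx : ∃ y' ∈ K, g • y' = x
    · simp [hx]
    · have : IsClosed ((g • ·) '' K) := (hK.image (isometry_smul _ g).continuous).isClosed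
      filter_upwards [this.isOpen_compl.mem_nhds hx] with z hz _
      exact hz
  obtain ⟨r, hr, hball⟩ := Metric.eventually_nhds_iff_ball.1 h1
  refine ⟨min r 1, lt_min hr one_pos, fun g y hy hxy => ?_⟩
  by_contra hcon
  refine hball (g • y) ?_ g ?_ hcon ⟨y, hy, rfl⟩
  · rw [Metric.mem_ball, dist_comm]
    exact hxy.trans_le (min_le_left _ _)
  · have h2 := hR hy
    have h3 := dist_triangle x (g • y) (g • P.center)
    rw [dist_smul] at h3
    exact h3.trans (add_le_add (hxy.le.trans (min_le_right _ _)) h2)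

/-- The folding map of hyperbolic space onto `P`. -/
noncomputable def fold (x : HypSpace n) : HypSpace n := (P.exists_smul_mem x).choose • x

theorem fold_mem (x : HypSpace n) : P.fold x ∈ P.carrier := (P.exists_smul_mem x).choose_spec

theorem fold_mem_orbit (x : HypSpace n) : P.fold x ∈ MulAction.orbit P.coxeterGroup x := ⟨_, rfl⟩

/-- Each orbit meets `P` only once, so the choice made in `fold` does not matter. -/
theorem fold_eq {x y : HypSpace n} (hy : y ∈ P.carrier)
    (hyx : y ∈ MulAction.orbit P.coxeterGroup x) : P.fold x = y := by
  obtain ⟨g, rfl⟩ := hyx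
  obtain ⟨h, hh⟩ := P.fold_mem_orbit x
  refine P.smul_eq_of_mem (P.fold_mem x) hy (g * h⁻¹) ?_
  rw [← hh]
  simp only [mul_smul, inv_smul_smul]

theorem fold_smul (g : P.coxeterGroup) (x : HypSpace n) : P.fold (g • x) = P.fold x :=
  P.fold_eq (P.fold_mem x) (by rw [MulAction.orbit_smul]; exact P.fold_mem_orbit x)

/-- By local finiteness, a translate of `P` containing a point near `x` contains `x` too, and
folding is an isometry on each translate. -/
theorem exists_ball_dist_fold (x : HypSpace n) :
    ∃ r > 0, ∀ y, dist x y < r → dist (P.fold x) (P.fold y) = dist x y := by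
  obtain ⟨r, hr, hball⟩ := P.exists_ball_mem_smul P.isCompact x
  refine ⟨r, hr, fun y hy => ?_⟩
  obtain ⟨g, hg⟩ := P.exists_smul_mem y
  obtain ⟨z, hz, rfl⟩ := hball g⁻¹ _ hg (by rwa [inv_smul_smul])
  have h1 : P.fold (g⁻¹ • z) = z := by
    rw [fold_smul]; exact P.fold_eq hz (MulAction.mem_orbit_self z)
  have h2 : P.fold y = g • y := P.fold_eq hg ⟨g, rfl⟩
  rw [h1, h2, ← dist_smul g (g⁻¹ • z), smul_inv_smul]

end RightAngledPolytope

namespace Colouring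

open Topology Filter

variable {n : ℕ} {P : RightAngledPolytope n} {V : Type*} [AddCommGroup V] [Module (ZMod 2) V]
  (col : Colouring P V)

theorem proj_surjective : Function.Surjective col.proj := OrbitSpace.proj_surjective _

theorem dist_proj_lt_iff (x y : HypSpace n) (r : ℝ) :
    dist (col.proj x) (col.proj y) < r ↔ ∃ g ∈ col.kernel, dist x (g • y) < r := by
  rw [proj, proj, OrbitSpace.dist_proj]
  constructor
  · intro h
    obtain ⟨g, hg⟩ := exists_lt_of_ciInf_lt h
    exact ⟨g, g.2, hg⟩
  · rintro ⟨g, hg, h⟩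
    exact (ciInf_le (OrbitSpace.bddBelow_dist col.kernel x y) ⟨g, hg⟩).trans_lt h

theorem dist_proj_le (x y : HypSpace n) : dist (col.proj x) (col.proj y) ≤ dist x y := by
  refine le_of_forall_gt fun r hr => ?_
  rw [dist_proj_lt_iff]
  exact ⟨1, one_mem _, by rwa [one_smul]⟩

theorem proj_eq_iff (x y : HypSpace n) :
    col.proj x = col.proj y ↔ ∃ g ∈ col.kernel, g • y = x := by
  refine (Quotient.eq (r := MulAction.orbitRel col.kernel (HypSpace n))).trans ?_
  change x ∈ MulAction.orbit col.kernel y ↔ _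
  constructor
  · rintro ⟨g, rfl⟩
    exact ⟨g, g.2, rfl⟩
  · rintro ⟨g, hg, rfl⟩
    exact ⟨⟨g, hg⟩, rfl⟩

theorem proj_smul {g : P.coxeterGroup} (hg : g ∈ col.kernel) (x : HypSpace n) :
    col.proj (g • x) = col.proj x :=
  (col.proj_eq_iff _ _).2 ⟨g, hg, rfl⟩

theorem image_proj_ball (x : HypSpace n) (r : ℝ) :
    col.proj '' Metric.ball x r = Metric.ball (col.proj x) r := by
  ext q
  constructor
  · rintro ⟨y, hy, rfl⟩
    exact (col.dist_proj_le y x).trans_lt hy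
  · intro hq
    obtain ⟨y, rfl⟩ := col.proj_surjective q
    rw [Metric.mem_ball, dist_comm, dist_proj_lt_iff] at hq
    obtain ⟨g, hg, hgy⟩ := hq
    exact ⟨g • y, by rwa [Metric.mem_ball, dist_comm], col.proj_smul hg y⟩

/-- The projection to `M_λ` is a local isometry. -/
theorem exists_dist_proj_eq (x : HypSpace n) : ∃ r > 0, ∀ s ≤ r, ∀ y ∈ Metric.ball x s,
    ∀ z ∈ Metric.ball x s, dist (col.proj y) (col.proj z) = dist y z := by
  -- If `dist y (g • z) < dist y z` with `y`, `z` in the ball of radius `r`, then `g` moves `x` by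
  -- less than `4r`. Displacements above `1` are handled by `r < 1/4`.
  have h1 : ∀ᶠ r in 𝓝[>] (0 : ℝ), ∀ g ∈ {g : P.coxeterGroup | dist x (g • x) ≤ 1},
      g ∈ col.kernel → g ≠ 1 → 4 * r < dist x (g • x) := by
    refine (eventually_all_finite (P.finite_dist_smul_le _ _ _)).2 fun g _ => ?_
    by_cases hg : g ∈ col.kernel ∧ g ≠ 1
    · have hpos : 0 < dist x (g • x) :=
        dist_pos.2 fun h => hg.2 (col.eq_one_of_smul_eq hg.1 h.symm)
      filter_upwards [nhdsWithin_le_nhds (Iio_mem_nhds (by positivity : 0 < dist x (g • x) / 4))]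
        with r hr _ _
      rw [Set.mem_Iio] at hr
      linarith
    · filter_upwards with r h h'
      exact absurd ⟨h, h'⟩ hg
  obtain ⟨r, ⟨hr, hr1⟩, hr0⟩ := ((h1.and (nhdsWithin_le_nhds
    (Iio_mem_nhds (by norm_num : (0 : ℝ) < 1 / 4)))).and
    (self_mem_nhdsWithin : Set.Ioi (0 : ℝ) ∈ 𝓝[>] 0)).exists
  refine ⟨r, hr0, fun s hs y hy z hz => ?_⟩
  rw [Metric.mem_ball] at hy hz
  refine le_antisymm (col.dist_proj_le y z) (not_lt.1 fun hlt => ?_)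
  obtain ⟨g, hg, hgz⟩ := (col.dist_proj_lt_iff y z _).1 hlt
  have hg1 : g ≠ 1 := by
    rintro rfl
    rw [one_smul] at hgz
    exact lt_irrefl _ hgz
  have h2 : 4 * r < dist x (g • x) := by
    by_cases hle : dist x (g • x) ≤ 1
    · exact hr g hle hg hg1
    · linarith
  have h3 := dist_triangle4 x y (g • z) (g • x)
  rw [dist_smul, dist_comm x y] at h3
  have h4 := dist_triangle y x z
  rw [dist_comm x z] at h4
  linarith

/-- Orbits are locally finite, so an infimum of zero is attained; this separates the points of the
quotient. -/
theorem eq_of_dist_proj_eq_zero (x y : HypSpace n) (h : dist (col.proj x) (col.proj y) = 0) :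
    col.proj x = col.proj y := by
  obtain ⟨r, hr, hball⟩ := P.exists_ball_mem_smul (isCompact_singleton (x := y)) x
  obtain ⟨g, hg, hgy⟩ := (col.dist_proj_lt_iff x y r).1 (h ▸ hr)
  obtain ⟨_, rfl, hy⟩ := hball g y rfl hgy
  exact (col.proj_eq_iff _ _).2 ⟨g, hg, hy⟩

theorem continuous_proj : Continuous col.proj :=
  (LipschitzWith.of_dist_le_mul (K := 1) fun x y => by
    simpa using col.dist_proj_le x y).continuous

theorem isHyperbolicManifold : IsHyperbolicManifold n col.Mfd := by
  refine ⟨?_, ?_, fun p => ?_⟩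
  · have : T0Space col.Mfd := by
      refine (t0Space_iff_inseparable _).2 fun p q hpq => ?_
      obtain ⟨x, rfl⟩ := col.proj_surjective p
      obtain ⟨y, rfl⟩ := col.proj_surjective q
      exact col.eq_of_dist_proj_eq_zero x y (Metric.inseparable_iff.1 hpq)
    infer_instance
  · have : TopologicalSpace.SeparableSpace col.Mfd :=
      col.proj_surjective.denseRange.separableSpace col.continuous_proj
    exact UniformSpace.secondCountable_of_separable _
  · obtain ⟨x, rfl⟩ := col.proj_surjective p
    obtain ⟨r, hr, hball⟩ := col.exists_dist_proj_eq x
    refine ⟨OpenPartialHomeomorph.ofIsometryOnBall col.proj x r (hball r le_rfl)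
      (col.image_proj_ball x r), fun p hp q hq => ?_, Metric.mem_ball_self hr⟩
    exact OpenPartialHomeomorph.ofIsometryOnBall_dist _ _ hp hq

variable {col} in
theorem IsCover.apply_proj {c : col.Mfd → P.carrier} (hc : col.IsCover c) (x : HypSpace n) :
    (c (col.proj x) : HypSpace n) = P.fold x :=
  (P.fold_eq (c (col.proj x)).2 (hc x)).symm

theorem existsUnique_isCover : ∃! c : col.Mfd → P.carrier, col.IsCover c := by
  refine ⟨fun q => ⟨P.fold (Function.surjInv col.proj_surjective q), P.fold_mem _⟩,
    fun x => ?_, fun c hc => ?_⟩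
  · obtain ⟨g, -, hg⟩ := (col.proj_eq_iff _ _).1
      (Function.surjInv_eq col.proj_surjective (col.proj x))
    change P.fold (Function.surjInv col.proj_surjective (col.proj x)) ∈ _
    rw [← hg, P.fold_smul]
    exact P.fold_mem_orbit x
  · funext q
    obtain ⟨x, rfl⟩ := col.proj_surjective q
    refine Subtype.ext ?_
    rw [hc.apply_proj x]
    obtain ⟨g, -, hg⟩ := (col.proj_eq_iff _ _).1
      (Function.surjInv_eq col.proj_surjective (col.proj x))
    change _ = P.fold (Function.surjInv col.proj_surjective (col.proj x))
    rw [← hg, P.fold_smul]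

variable {col} in
theorem IsCover.continuous {c : col.Mfd → P.carrier} (hc : col.IsCover c) : Continuous c := by
  rw [Metric.continuous_iff]
  intro q ε hε
  obtain ⟨x, rfl⟩ := col.proj_surjective q
  obtain ⟨r, hr, hball⟩ := P.exists_ball_dist_fold x
  refine ⟨min r ε, lt_min hr hε, fun q hq => ?_⟩
  obtain ⟨y, rfl⟩ := col.proj_surjective q
  rw [dist_comm, dist_proj_lt_iff] at hq
  obtain ⟨g, -, hgy⟩ := hq
  rw [dist_comm, Subtype.dist_eq, hc.apply_proj, hc.apply_proj, ← P.fold_smul g y,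
    hball _ (hgy.trans_le (min_le_left _ _))]
  exact hgy.trans_le (min_le_right _ _)

end Colouring

/-! ### Linearity of isometries, hyperplanes, and facets as polytopes -/

/-- The Lorentzian product as a bilinear form. -/
noncomputable def lorentzForm (n : ℕ) : LinearMap.BilinForm ℝ (Minkowski n) :=
  LinearMap.mk₂ ℝ lorentz lorentz_add_left lorentz_smul_left lorentz_add_right lorentz_smul_right

theorem lorentzForm_apply {n : ℕ} (x y : Minkowski n) : lorentzForm n x y = lorentz x y := rfl

namespace HypSpace

variable {n m : ℕ}

/-- Adding a large multiple of `x` makes any vector time-like and future-directed. The value of `T`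
is one for which `q + 2Tb - T² < 0` and `b < T`. -/
theorem exists_eq_smul_sub_smul (x : HypSpace n) (v : Minkowski n) :
    ∃ y : HypSpace n, ∃ a b : ℝ, a ≠ 0 ∧ v = a • y.vec - b • x.vec := by
  set q := lorentz v v
  set b := lorentz x.vec v with hb
  set T := 1 + |q| + 2 * |b| with hT
  have h1 : T * T = T + T * |q| + 2 * T * |b| := by
    conv_lhs => rw [hT, add_mul, add_mul]
    rw [← hT]; ring
  have hq := le_abs_self q
  have hq0 := abs_nonneg q
  have hb0 := abs_nonneg b
  have hbb := le_abs_self b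
  have hT1 : 1 ≤ T := by rw [hT]; linarith
  obtain ⟨y, c, hc, hy⟩ := x.exists_vec_eq_smul (v + T • x.vec)
    (by
      simp only [lorentz_add_left, lorentz_add_right, lorentz_smul_left, lorentz_smul_right,
        x.lorentz_self, lorentz_comm v x.vec, ← hb]
      nlinarith [mul_le_mul_of_nonneg_left hbb (by linarith : 0 ≤ T),
        mul_le_mul_of_nonneg_right hT1 hq0])
    (by
      rw [lorentz_add_right, lorentz_smul_right, x.lorentz_self, ← hb]
      linarith)
  refine ⟨y, c⁻¹, T, inv_ne_zero hc.ne', ?_⟩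
  rw [hy, smul_smul, inv_mul_cancel₀ hc.ne', one_smul, add_sub_cancel_right]

theorem span_range_vec : Submodule.span ℝ (Set.range (HypSpace.vec : HypSpace n → _)) = ⊤ := by
  refine eq_top_iff.2 fun v _ => ?_
  obtain ⟨y, a, b, -, hv⟩ := (origin n).exists_eq_smul_sub_smul v
  rw [hv]
  exact sub_mem (Submodule.smul_mem _ _ (Submodule.subset_span ⟨y, rfl⟩))
    (Submodule.smul_mem _ _ (Submodule.subset_span ⟨_, rfl⟩))

/-- An isometric map between hyperbolic spaces is induced by a linear map. -/
theorem exists_linearMap_of_isometry {j : HypSpace n → HypSpace m} (hj : Isometry j) :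
    ∃ J : Minkowski n →ₗ[ℝ] Minkowski m, (∀ x, (j x).vec = J x.vec) ∧
      ∀ u v, lorentz (J u) (J v) = lorentz u v := by
  obtain ⟨B, hB, hspan, hli⟩ :=
    exists_linearIndependent ℝ (Set.range (HypSpace.vec : HypSpace n → _))
  rw [span_range_vec] at hspan
  let b : Module.Basis B ℝ (Minkowski n) := Module.Basis.mk hli (by rw [Subtype.range_coe, hspan])
  choose p hp using fun i : B => hB i.2
  have hb : ∀ i, b i = (p i).vec := fun i => by rw [hp, Module.Basis.mk_apply]
  let J : Minkowski n →ₗ[ℝ] Minkowski m := b.constr ℝ fun i => (j (p i)).vec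
  have hJ : ∀ i, J (b i) = (j (p i)).vec := fun i => b.constr_basis ℝ _ i
  have hdist : ∀ x y, lorentz (j x).vec (j y).vec = lorentz x.vec y.vec := fun x y =>
    (dist_eq_dist_iff _ _ _ _).1 (hj.dist_eq x y)
  have h1 : ∀ u v, lorentz (J u) (J v) = lorentz u v := by
    have : (lorentzForm m).comp J J = lorentzForm n := by
      refine LinearMap.BilinForm.ext_basis b fun i k => ?_
      rw [LinearMap.BilinForm.comp_apply, lorentzForm_apply, lorentzForm_apply, hJ, hJ, hb, hb,
        hdist]
    intro u v
    rw [← lorentzForm_apply, ← lorentzForm_apply, ← this, LinearMap.BilinForm.comp_apply]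
  refine ⟨J, fun x => ?_, h1⟩
  have h2 : ∀ u, lorentz (j x).vec (J u) = lorentz x.vec u := by
    have : (lorentzForm m (j x).vec).comp J = lorentzForm n x.vec := by
      refine b.ext fun i => ?_
      rw [LinearMap.comp_apply, lorentzForm_apply, lorentzForm_apply, hJ, hb, hdist]
    intro u
    rw [← lorentzForm_apply, ← lorentzForm_apply, ← this, LinearMap.comp_apply]
  -- The difference of `j x` and the image of `x` under `J` is orthogonal to the point `j x` and
  -- null, hence zero; no surjectivity of `j` is needed.
  refine sub_eq_zero.1 ((j x).eq_zero_of_lorentz_self_eq_zero _ ?_ ?_)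
  · rw [lorentz_sub_right, h2, (j x).lorentz_self, x.lorentz_self]; ring
  · simp only [lorentz_sub_left, lorentz_sub_right, h1, h2, lorentz_comm (J x.vec) (j x).vec,
      (j x).lorentz_self, x.lorentz_self]
    ring

end HypSpace

/-- `j` identifies hyperbolic space isometrically with the hyperplane orthogonal to `e`. -/
structure IsHyperplaneModel {n : ℕ} (e : UnitNormal (n + 1))
    (j : HypSpace n → HypSpace (n + 1)) : Prop where
  isometry : Isometry j
  range_eq : Set.range j = e.hyperplane

namespace UnitNormal

variable {n : ℕ}

theorem lorentz_reflectVec_left (e : UnitNormal n) (x y : Minkowski n) :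
    lorentz (e.reflectVec x) y = lorentz x (e.reflectVec y) := by
  simp only [reflectVec, lorentz_sub_left, lorentz_sub_right, lorentz_smul_left,
    lorentz_smul_right, lorentz_comm e.vec y]
  ring

/-- The reflection along `e - e'` exchanges the two; the sign condition makes this difference
space-like. -/
theorem exists_reflectVec_eq (e e' : UnitNormal n) (h : lorentz e.vec e'.vec ≤ 0) :
    ∃ f : UnitNormal n, f.reflectVec e'.vec = e.vec := by
  set c := lorentz e.vec e'.vec with hc
  have h1 : 0 < √(2 - 2 * c) := Real.sqrt_pos.2 (by linarith)
  have h2 : √(2 - 2 * c) * √(2 - 2 * c) = 2 - 2 * c := Real.mul_self_sqrt (by linarith)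
  have h3 : lorentz (e.vec - e'.vec) (e.vec - e'.vec) = 2 - 2 * c := by
    simp only [lorentz_sub_left, lorentz_sub_right, e.lorentz_self, e'.lorentz_self,
      lorentz_comm e'.vec e.vec, ← hc]
    ring
  have h4 : lorentz e'.vec (e.vec - e'.vec) = c - 1 := by
    rw [lorentz_sub_right, e'.lorentz_self, lorentz_comm]
  generalize √(2 - 2 * c) = s at h1 h2
  refine ⟨⟨s⁻¹ • (e.vec - e'.vec), ?_⟩, ?_⟩
  · rw [lorentz_smul_left, lorentz_smul_right, h3, ← h2]
    field_simp
  · have h5 : 2 * (s⁻¹ * (c - 1)) * s⁻¹ = -1 := by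
      have h6 : c - 1 = -(s * s) / 2 := by linarith
      rw [h6]
      field_simp
    rw [reflectVec, lorentz_smul_right, h4, smul_smul, h5]
    module

/-- Every hyperplane is isometric to hyperbolic space of one dimension less. -/
theorem exists_isHyperplaneModel (e : UnitNormal (n + 1)) :
    ∃ j : HypSpace n → HypSpace (n + 1), IsHyperplaneModel e j := by
  -- Reduction to a hyperplane through the origin: the sign of `u` is chosen so that a reflection
  -- takes `(0, u)` to `e`. The model is the inclusion of `u⊥` followed by this reflection.
  obtain ⟨u, hu, hue⟩ : ∃ u : EuclideanSpace ℝ (Fin (n + 1)), ‖u‖ = 1 ∧ inner ℝ e.vec.2 u ≤ 0 := by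
    rcases le_total (inner ℝ e.vec.2 (EuclideanSpace.single (0 : Fin (n + 1)) (1 : ℝ))) 0 with h | h
    · exact ⟨_, by simp, h⟩
    · exact ⟨-EuclideanSpace.single (0 : Fin (n + 1)) (1 : ℝ), by simp, by
        rw [inner_neg_right]; linarith⟩
  let e' : UnitNormal (n + 1) := ⟨(0, u), by
    simp [lorentz, hu]⟩
  obtain ⟨f, hf⟩ := e.exists_reflectVec_eq e' (by simpa [lorentz, e'] using hue)
  have hf' : f.reflectVec e.vec = e'.vec := by rw [← hf, f.reflectVec_reflectVec]
  have he' : ∀ v : Minkowski (n + 1), lorentz v e'.vec = inner ℝ v.2 u := by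
    intro v; simp [lorentz, e']
  have hfact : Fact (Module.finrank ℝ (EuclideanSpace ℝ (Fin (n + 1))) = n + 1) := ⟨by simp⟩
  have hu0 : u ≠ 0 := by rintro rfl; simp at hu
  let L : EuclideanSpace ℝ (Fin n) →ₗᵢ[ℝ] EuclideanSpace ℝ (Fin (n + 1)) :=
    (Submodule.span ℝ {u})ᗮ.subtypeₗᵢ.comp
      (OrthonormalBasis.fromOrthogonalSpanSingleton n hu0).repr.symm.toLinearIsometry
  have hL : ∀ v, inner ℝ (L v) u = 0 := fun v =>
    Submodule.mem_orthogonal_singleton_iff_inner_left.1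
      ((OrthonormalBasis.fromOrthogonalSpanSingleton n hu0).repr.symm v).2
  have hL' : ∀ w, inner ℝ w u = 0 → ∃ v, L v = w := fun w hw =>
    ⟨(OrthonormalBasis.fromOrthogonalSpanSingleton n hu0).repr
      ⟨w, Submodule.mem_orthogonal_singleton_iff_inner_left.2 hw⟩, by simp [L]⟩
  have hlor : ∀ x y : Minkowski n, lorentz (n := n + 1) (x.1, L x.2) (y.1, L y.2) = lorentz x y := by
    intro x y; simp [lorentz]
  let i : HypSpace n → HypSpace (n + 1) := fun x =>
    ⟨(x.vec.1, L x.vec.2), by rw [hlor, x.lorentz_self], x.time_pos⟩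
  have hi : Isometry i := Isometry.of_dist_eq fun x y =>
    (HypSpace.dist_eq_dist_iff _ _ _ _).2 (hlor _ _)
  refine ⟨fun x => f.reflection (i x), f.reflection.isometry.comp hi, ?_⟩
  ext y
  constructor
  · rintro ⟨x, rfl⟩
    change lorentz (f.reflectVec (i x).vec) e.vec = 0
    rw [lorentz_reflectVec_left, hf', he']
    exact hL _
  · intro hy
    have h1 : lorentz (f.reflection y).vec e'.vec = 0 := by
      change lorentz (f.reflectVec y.vec) e'.vec = 0
      rw [lorentz_reflectVec_left, hf]
      exact hy
    rw [he'] at h1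
    obtain ⟨v, hv⟩ := hL' _ h1
    have h2 : ((f.reflection y).vec.1, L v) = (f.reflection y).vec := by rw [hv]
    have h3 : lorentz (n := n) ((f.reflection y).vec.1, v) ((f.reflection y).vec.1, v) = -1 := by
      rw [← hlor, h2, (f.reflection y).lorentz_self]
    refine ⟨⟨_, h3, (f.reflection y).time_pos⟩, ?_⟩
    have h4 : i ⟨_, h3, (f.reflection y).time_pos⟩ = f.reflection y := HypSpace.ext h2
    change f.reflection (i _) = y
    rw [h4]
    exact f.reflection.symm_apply_apply y

end UnitNormal

namespace IsHyperplaneModel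

variable {n : ℕ} {e : UnitNormal (n + 1)} {j : HypSpace n → HypSpace (n + 1)}
  (h : IsHyperplaneModel e j)

/-- The linear map that induces `j`. -/
noncomputable def lin : Minkowski n →ₗ[ℝ] Minkowski (n + 1) :=
  (HypSpace.exists_linearMap_of_isometry h.isometry).choose

theorem vec_apply (x : HypSpace n) : (j x).vec = h.lin x.vec :=
  (HypSpace.exists_linearMap_of_isometry h.isometry).choose_spec.1 x

theorem lorentz_lin (u v : Minkowski n) : lorentz (h.lin u) (h.lin v) = lorentz u v :=
  (HypSpace.exists_linearMap_of_isometry h.isometry).choose_spec.2 u v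

theorem lin_injective : Function.Injective h.lin := by
  intro u v huv
  have h1 : ∀ w, lorentz w (u - v) = 0 := fun w => by
    rw [← h.lorentz_lin, map_sub, huv, sub_self, lorentz_zero_right]
  exact sub_eq_zero.1 ((HypSpace.origin n).eq_zero_of_lorentz_self_eq_zero _ (h1 _) (h1 _))

theorem lorentz_apply_normal (h : IsHyperplaneModel e j) (x : HypSpace n) : lorentz (j x).vec e.vec = 0 := by
  have : j x ∈ e.hyperplane := h.range_eq ▸ Set.mem_range_self x
  exact this

theorem exists_apply_eq (h : IsHyperplaneModel e j) {y : HypSpace (n + 1)} (hy : lorentz y.vec e.vec = 0) : ∃ x, j x = y := by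
  have : y ∈ Set.range j := h.range_eq ▸ hy
  exact this

theorem exists_lin_eq {w : Minkowski (n + 1)} (hw : lorentz w e.vec = 0) :
    ∃ u, h.lin u = w := by
  obtain ⟨y, a, b, ha, rfl⟩ := (j (HypSpace.origin n)).exists_eq_smul_sub_smul w
  rw [lorentz_sub_left, lorentz_smul_left, lorentz_smul_left, h.lorentz_apply_normal, mul_zero,
    sub_zero, mul_eq_zero, or_iff_right ha] at hw
  obtain ⟨x, rfl⟩ := h.exists_apply_eq hw
  exact ⟨a • x.vec - b • (HypSpace.origin n).vec, by
    rw [map_sub, map_smul, map_smul, ← h.vec_apply, ← h.vec_apply]⟩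

variable {P : RightAngledPolytope (n + 1)} {F : Facet P.carrier} {C : Set (HypSpace n)}

/-- The normal of an adjacent facet is orthogonal to that of `F`, hence is tangent to the hyperplane
and comes from a vector of the smaller Minkowski space. -/
theorem exists_facet_lin_eq (h : IsHyperplaneModel F.normal j) (hC : ∀ x, x ∈ C ↔ j x ∈ P.carrier)
    {G : Facet P.carrier} (hG : F.Adjacent G) :
    ∃ E : Facet C, h.lin E.normal.vec = G.normal.vec := by
  obtain ⟨u, hu⟩ := h.exists_lin_eq (w := G.normal.vec)
    (by rw [lorentz_comm, RightAngledPolytope.lorentz_eq_zero_of_adjacent hG])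
  have hval : ∀ x, lorentz x.vec u = lorentz (j x).vec G.normal.vec := fun x => by
    rw [h.vec_apply, ← hu, h.lorentz_lin]
  obtain ⟨-, z, ⟨hzF, hzG⟩, ε, hε, hball⟩ := hG
  obtain ⟨x, rfl⟩ := h.exists_apply_eq hzF
  refine ⟨⟨⟨u, by rw [← h.lorentz_lin, hu, G.normal.lorentz_self]⟩, fun y hy => ?_, x, ?_, ε, hε,
    fun y hy => ?_⟩, hu⟩
  · change lorentz y.vec u ≤ 0
    rw [hval]
    exact G.subset_halfSpace ((hC y).1 hy)
  · change lorentz x.vec u = 0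
    rw [hval]
    exact hzG
  · rw [hC]
    refine hball ⟨?_, h.lorentz_apply_normal y, ?_⟩
    · rw [Metric.mem_ball, h.isometry.dist_eq]; exact hy.1
    · change lorentz (j y).vec G.normal.vec = 0
      rw [← hval]
      exact hy.2

theorem exists_halfSpaces (h : IsHyperplaneModel F.normal j)
    (hC : ∀ x, x ∈ C ↔ j x ∈ P.carrier) :
    ∃ S : Set (UnitNormal n), S.Finite ∧ C = ⋂ u ∈ S, u.halfSpace ∧
      ∀ u ∈ S, ∃ G, F.Adjacent G ∧ h.lin u.vec = G.normal.vec := by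
  choose E hE using fun G : {G : Facet P.carrier // F.Adjacent G} => h.exists_facet_lin_eq hC G.2
  refine ⟨Set.range fun G => (E G).normal, Set.finite_range _, ?_, ?_⟩
  · ext x
    have hval : ∀ G, lorentz x.vec (E G).normal.vec = lorentz (j x).vec G.1.normal.vec :=
      fun G => by rw [h.vec_apply, ← hE, h.lorentz_lin]
    simp only [Set.mem_iInter, Set.forall_mem_range]
    constructor
    · exact fun hx G => (E G).subset_halfSpace hx
    · intro hx
      rw [hC]
      refine RightAngledPolytope.mem_carrier_of_adjacent F (h.lorentz_apply_normal x)
        fun G hG => ?_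
      rw [← hval ⟨G, hG⟩]
      exact hx _
  · rintro _ ⟨G, rfl⟩
    exact ⟨G.1, G.2, hE G⟩

theorem interior_nonempty (h : IsHyperplaneModel F.normal j)
    (hC : ∀ x, x ∈ C ↔ j x ∈ P.carrier) : (interior C).Nonempty := by
  obtain ⟨z, hz, ε, hε, hball⟩ := F.full
  obtain ⟨x, rfl⟩ := h.exists_apply_eq hz
  refine ⟨x, mem_interior_iff_mem_nhds.2 (Metric.mem_nhds_iff.2 ⟨ε, hε, fun y hy => ?_⟩)⟩
  rw [hC]
  exact hball ⟨by rwa [Metric.mem_ball, h.isometry.dist_eq], h.lorentz_apply_normal y⟩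

theorem exists_adjacent_lin_eq (h : IsHyperplaneModel F.normal j)
    (hC : ∀ x, x ∈ C ↔ j x ∈ P.carrier) (E : Facet C) :
    ∃ G, F.Adjacent G ∧ h.lin E.normal.vec = G.normal.vec := by
  obtain ⟨S, hS, hCS, hSG⟩ := h.exists_halfSpaces hC
  exact hSG _ (E.normal_mem hS hCS (h.interior_nonempty hC))

/-- The facets of `F` have the normals of facets of `P` adjacent to `F`; two of them that meet are
orthogonal because the facets of `P` are. -/
theorem exists_isFacetModel (h : IsHyperplaneModel F.normal j) :
    ∃ Q : RightAngledPolytope n, IsFacetModel F Q j := by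
  have hC : ∀ x, x ∈ j ⁻¹' P.carrier ↔ j x ∈ P.carrier := fun _ => Iff.rfl
  have himage : j '' (j ⁻¹' P.carrier) = F.carrier := by
    rw [Set.image_preimage_eq_inter_range, h.range_eq, Facet.carrier]
  refine ⟨⟨j ⁻¹' P.carrier, ?_, h.interior_nonempty hC, ?_, fun E E' hEE' => ?_⟩,
    h.isometry, h.range_eq, himage⟩
  · have hF : IsCompact F.carrier := P.isCompact.inter_right
      (isClosed_eq (HypSpace.continuous_lorentz _) continuous_const)
    rwa [← himage, ← h.isometry.isEmbedding.isCompact_iff] at hF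
  · obtain ⟨S, hS, hCS, -⟩ := h.exists_halfSpaces hC
    exact ⟨S, hS, hCS⟩
  · obtain ⟨G, -, hG⟩ := h.exists_adjacent_lin_eq hC E
    obtain ⟨G', -, hG'⟩ := h.exists_adjacent_lin_eq hC E'
    obtain ⟨hne, x, ⟨hx, hx'⟩, ε, hε, hball⟩ := hEE'
    have hxP : j x ∈ P.carrier := hball ⟨Metric.mem_ball_self hε, hx, hx'⟩
    have hGG' : G ≠ G' := by
      rintro rfl
      apply hne
      exact Facet.normal_injective (UnitNormal.ext (h.lin_injective (hG.trans hG'.symm)))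
    rw [Facet.dihedralAngle, Real.arccos_eq_pi_div_two, neg_eq_zero, ← h.lorentz_lin, hG, hG']
    refine RightAngledPolytope.lorentz_eq_zero_of_mem hGG' (x := j x) ⟨hxP, ?_⟩ ⟨hxP, ?_⟩
    · change lorentz (j x).vec G.normal.vec = 0
      rw [h.vec_apply, ← hG, h.lorentz_lin]
      exact hx
    · change lorentz (j x).vec G'.normal.vec = 0
      rw [h.vec_apply, ← hG', h.lorentz_lin]
      exact hx'

end IsHyperplaneModel

/-! ### The induced colouring, and comparison of `(Γ_F)_μ` with `Γ_λ` -/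

namespace IsFacetModel

variable {n : ℕ} {P : RightAngledPolytope (n + 1)} {F : Facet P.carrier}
  {Q : RightAngledPolytope n} {j : HypSpace n → HypSpace (n + 1)}

theorem isHyperplaneModel (h : IsFacetModel F Q j) : IsHyperplaneModel F.normal j := ⟨h.1, h.2.1⟩

theorem mem_facet_iff (h : IsFacetModel F Q j) (x : HypSpace n) : x ∈ Q.carrier ↔ j x ∈ F.carrier := by
  rw [← h.2.2]
  exact (h.1.injective.mem_set_image).symm

theorem mem_iff (h : IsFacetModel F Q j) (x : HypSpace n) : x ∈ Q.carrier ↔ j x ∈ P.carrier := by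
  rw [h.mem_facet_iff]
  exact ⟨fun hx => hx.1, fun hx => ⟨hx, h.isHyperplaneModel.lorentz_apply_normal x⟩⟩

/-- The facet of `P` that cuts out a given face of codimension one of `F`. -/
noncomputable def facetMap (h : IsFacetModel F Q j) (E : Facet Q.carrier) : Facet P.carrier :=
  (h.isHyperplaneModel.exists_adjacent_lin_eq h.mem_iff E).choose

theorem adjacent_facetMap (h : IsFacetModel F Q j) (E : Facet Q.carrier) :
    F.Adjacent (h.facetMap E) :=
  (h.isHyperplaneModel.exists_adjacent_lin_eq h.mem_iff E).choose_spec.1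

theorem lin_normal (h : IsFacetModel F Q j) (E : Facet Q.carrier) :
    h.isHyperplaneModel.lin E.normal.vec = (h.facetMap E).normal.vec :=
  (h.isHyperplaneModel.exists_adjacent_lin_eq h.mem_iff E).choose_spec.2

theorem lorentz_facetMap (h : IsFacetModel F Q j) (E : Facet Q.carrier) (x : HypSpace n) :
    lorentz (j x).vec (h.facetMap E).normal.vec = lorentz x.vec E.normal.vec := by
  rw [h.isHyperplaneModel.vec_apply, ← h.lin_normal, h.isHyperplaneModel.lorentz_lin]

theorem mem_facetMap_iff (h : IsFacetModel F Q j) (E : Facet Q.carrier) (x : HypSpace n) :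
    j x ∈ (h.facetMap E).carrier ↔ x ∈ E.carrier := by
  change j x ∈ P.carrier ∧ lorentz _ _ = 0 ↔ x ∈ Q.carrier ∧ lorentz _ _ = 0
  rw [h.lorentz_facetMap, h.mem_iff]

theorem facetMap_injective (h : IsFacetModel F Q j) : Function.Injective h.facetMap := by
  intro E E' hEE'
  refine Facet.normal_injective (UnitNormal.ext (h.isHyperplaneModel.lin_injective ?_))
  rw [h.lin_normal, h.lin_normal, hEE']

theorem image_carrier (h : IsFacetModel F Q j) (E : Facet Q.carrier) :
    j '' E.carrier = F.carrier ∩ (h.facetMap E).carrier := by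
  ext y
  constructor
  · rintro ⟨x, hx, rfl⟩
    exact ⟨(h.mem_facet_iff x).1 hx.1, (h.mem_facetMap_iff E x).2 hx⟩
  · rintro ⟨hyF, hyE⟩
    obtain ⟨x, rfl⟩ := h.isHyperplaneModel.exists_apply_eq hyF.2
    exact ⟨x, (h.mem_facetMap_iff E x).1 hyE, rfl⟩

/-- Every facet of `P` that meets `F` cuts out a face of codimension one. -/
theorem exists_facetMap_eq (h : IsFacetModel F Q j) {G : Facet P.carrier} (hG : G ≠ F)
    {x : HypSpace (n + 1)} (hxF : x ∈ F.carrier) (hxG : x ∈ G.carrier) :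
    ∃ E, h.facetMap E = G := by
  obtain ⟨E, hE⟩ := h.isHyperplaneModel.exists_facet_lin_eq h.mem_iff
    (RightAngledPolytope.adjacent_of_mem hG.symm hxF hxG)
  exact ⟨E, Facet.normal_injective (UnitNormal.ext (by rw [← h.lin_normal, hE]))⟩

/-- A relative interior point of `E` lies on no other facet of `Q`, so it determines `G`; this makes
the induced colouring unique. -/
theorem eq_facetMap (h : IsFacetModel F Q j) (E : Facet Q.carrier) {G : Facet P.carrier}
    (hG : G ≠ F) (hEG : j '' E.carrier = F.carrier ∩ G.carrier) : G = h.facetMap E := by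
  obtain ⟨z, hz, hneg⟩ := RightAngledPolytope.exists_mem_hyperplane_lorentz_neg E
  have hzE : z ∈ E.carrier := by
    refine ⟨(Q.mem_carrier_iff z).2 fun K => ?_, hz⟩
    by_cases hK : K = E
    · rw [hK]; exact le_of_eq hz
    · exact (hneg K hK).le
  have hjz : j z ∈ F.carrier ∩ G.carrier := hEG ▸ Set.mem_image_of_mem j hzE
  obtain ⟨E', rfl⟩ := h.exists_facetMap_eq hG hjz.1 hjz.2
  congr 1
  by_contra hne
  exact (hneg E' hne).ne ((h.mem_facetMap_iff E' z).1 hjz.2).2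

section Colouring

variable {V : Type*} [AddCommGroup V] [Module (ZMod 2) V] (col : Colouring P V)

theorem isInducedColouring_iff (h : IsFacetModel F Q j)
    (μ : Colouring Q (V ⧸ Submodule.span (ZMod 2) {col.colour F})) :
    IsInducedColouring col F j μ ↔
      ∀ E, μ.colour E = Submodule.Quotient.mk (col.colour (h.facetMap E)) := by
  constructor
  · intro hμ E
    obtain ⟨G, hG, hEG, hE⟩ := hμ E
    rw [hE, h.eq_facetMap E hG hEG]
  · exact fun hμ E => ⟨h.facetMap E, (h.adjacent_facetMap E).1.symm, h.image_carrier E, hμ E⟩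

/-- The colouring of a facet induced by a colouring of `P`. -/
noncomputable def inducedColouring (h : IsFacetModel F Q j) :
    Colouring Q (V ⧸ Submodule.span (ZMod 2) {col.colour F}) where
  colour E := Submodule.Quotient.mk (col.colour (h.facetMap E))
  linearIndependent q hq := by
    have hqF : j q ∈ F.carrier := (h.mem_facet_iff q).1 hq.1
    have hli := col.linearIndependent_of_mem hqF.1
    let i : {E : Facet Q.carrier // q ∈ E.carrier} → {G : Facet P.carrier // j q ∈ G.carrier} :=
      fun E => ⟨h.facetMap E.1, (h.mem_facetMap_iff E.1 q).2 E.2⟩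
    have hi : Function.Injective i := fun E E' hEE' =>
      Subtype.ext (h.facetMap_injective (congrArg (fun K => K.1) hEE'))
    refine (hli.comp i hi).map (f := Submodule.mkQ _) ?_
    rw [Submodule.ker_mkQ, Set.range_comp]
    -- At `j q` the colour of `F` is independent of the other colours, so these stay independent
    -- modulo its span.
    have := hli.disjoint_span_image (s := Set.range i) (t := {⟨F, hqF⟩}) (by
      rw [Set.disjoint_singleton_right]
      rintro ⟨E, hE⟩
      exact (h.adjacent_facetMap E.1).1 (congrArg (fun K => K.1) hE).symm)
    rwa [Set.image_singleton] at this

theorem existsUnique_isInducedColouring (h : IsFacetModel F Q j) :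
    ∃! μ : Colouring Q (V ⧸ Submodule.span (ZMod 2) {col.colour F}),
      IsInducedColouring col F j μ :=
  ⟨h.inducedColouring col, (h.isInducedColouring_iff col _).2 fun _ => rfl, fun μ hμ =>
    Colouring.ext (funext fun E => (h.isInducedColouring_iff col μ).1 hμ E)⟩

end Colouring

/-- The homomorphism from the Coxeter group of `F` to the Coxeter group of `P`. -/
noncomputable def groupHom (h : IsFacetModel F Q j) : Q.coxeterGroup →* P.coxeterGroup :=
  PresentedGroup.toGroup (f := fun E => P.gen (h.facetMap E)) (by
    rintro w (⟨E, rfl⟩ | ⟨E, E', ⟨hne, x, ⟨hx, hx'⟩, ε, hε, hball⟩, rfl⟩)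
    · rw [map_pow, FreeGroup.lift_apply_of, pow_two, P.gen_mul_gen]
    · simp only [map_mul, map_inv, FreeGroup.lift_apply_of]
      rw [mul_inv_eq_one, mul_inv_eq_iff_eq_mul]
      have hxQ : x ∈ Q.carrier := hball ⟨Metric.mem_ball_self hε, hx, hx'⟩
      exact RightAngledPolytope.gen_mul_comm (RightAngledPolytope.adjacent_of_mem
        (h.facetMap_injective.ne hne) ((h.mem_facetMap_iff E x).2 ⟨hxQ, hx⟩)
        ((h.mem_facetMap_iff E' x).2 ⟨hxQ, hx'⟩)))

theorem groupHom_gen (h : IsFacetModel F Q j) (E : Facet Q.carrier) :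
    h.groupHom (Q.gen E) = P.gen (h.facetMap E) :=
  PresentedGroup.toGroup.of _

theorem apply_gen_smul (h : IsFacetModel F Q j) (E : Facet Q.carrier) (x : HypSpace n) :
    j (Q.gen E • x) = P.gen (h.facetMap E) • j x := by
  apply HypSpace.ext
  rw [h.isHyperplaneModel.vec_apply, Q.gen_smul, P.gen_smul]
  change h.isHyperplaneModel.lin (E.normal.reflectVec x.vec) =
    (h.facetMap E).normal.reflectVec (j x).vec
  rw [UnitNormal.reflectVec, UnitNormal.reflectVec, h.lorentz_facetMap,
    h.isHyperplaneModel.vec_apply, map_sub, map_smul, h.lin_normal]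

theorem apply_smul (h : IsFacetModel F Q j) (g : Q.coxeterGroup) :
    ∀ x : HypSpace n, j (g • x) = h.groupHom g • j x := by
  have hg : g ∈ Subgroup.closure (Set.range Q.gen) := by
    rw [Q.closure_range_gen]; trivial
  induction hg using Subgroup.closure_induction with
  | mem g hg =>
    obtain ⟨E, rfl⟩ := hg
    intro x
    rw [h.groupHom_gen, h.apply_gen_smul]
  | one => intro x; rw [map_one, one_smul, one_smul]
  | mul a b _ _ ha hb => intro x; rw [map_mul, mul_smul, mul_smul, ha, hb]
  | inv a _ ha =>
    intro x
    rw [map_inv, eq_inv_smul_iff, ← ha, smul_inv_smul]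

theorem gen_smul_apply (h : IsFacetModel F Q j) (x : HypSpace n) : P.gen F • j x = j x :=
  P.gen_smul_eq_self (h.isHyperplaneModel.lorentz_apply_normal x)

section InducedColouring

variable {V : Type*} [AddCommGroup V] [Module (ZMod 2) V] {col : Colouring P V}
  {μ : Colouring Q (V ⧸ Submodule.span (ZMod 2) {col.colour F})}

theorem hom_eq_mk (h : IsFacetModel F Q j) (hμ : IsInducedColouring col F j μ)
    (g : Q.coxeterGroup) :
    (μ.hom g).toAdd = Submodule.Quotient.mk (col.hom (h.groupHom g)).toAdd := by
  rw [h.isInducedColouring_iff] at hμ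
  have hg : g ∈ Subgroup.closure (Set.range Q.gen) := by
    rw [Q.closure_range_gen]; trivial
  induction hg using Subgroup.closure_induction with
  | mem g hg =>
    obtain ⟨E, rfl⟩ := hg
    rw [μ.hom_gen, h.groupHom_gen, col.hom_gen, toAdd_ofAdd, toAdd_ofAdd, hμ]
  | one => simp
  | mul a b _ _ ha hb =>
    simp only [map_mul, toAdd_mul, ha, hb, Submodule.Quotient.mk_add]
  | inv a _ ha =>
    simp only [map_inv, toAdd_inv, ha, Submodule.Quotient.mk_neg]

/-- Elements of `(Γ_F)_μ` act as elements of `Γ_λ`. -/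
theorem exists_mem_kernel (h : IsFacetModel F Q j) (hμ : IsInducedColouring col F j μ)
    {g : Q.coxeterGroup} (hg : g ∈ μ.kernel) :
    ∃ k ∈ col.kernel, ∀ x, j (g • x) = k • j x := by
  have h1 := h.hom_eq_mk hμ g
  rw [MonoidHom.mem_ker.1 hg, toAdd_one, eq_comm, Submodule.Quotient.mk_eq_zero,
    Submodule.mem_span_singleton] at h1
  obtain ⟨a, ha⟩ := h1
  have h01 : ∀ a : ZMod 2, a = 0 ∨ a = 1 := by decide
  rcases h01 a with rfl | rfl
  · rw [zero_smul] at ha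
    exact ⟨h.groupHom g, MonoidHom.mem_ker.2 (toAdd_eq_zero.1 ha.symm), h.apply_smul g⟩
  · rw [one_smul] at ha
    -- The image of `g` has the colour of `F`; the factor `r_F` cancels it and acts trivially on the
    -- hyperplane.
    refine ⟨h.groupHom g * P.gen F, MonoidHom.mem_ker.2 (toAdd_eq_zero.1 ?_), fun x => ?_⟩
    · rw [map_mul, toAdd_mul, col.hom_gen, toAdd_ofAdd, ← ha, ZModModule.add_self]
    · rw [mul_smul, h.gen_smul_apply, h.apply_smul]

/-- The stabilizer of a point of `F` is generated by `r_F` and the stabilizer in the Coxeter group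
of `F`. -/
theorem exists_smul_eq_of_mem_closure (h : IsFacetModel F Q j) {q : HypSpace n}
    (hq : q ∈ Q.carrier) {g : P.coxeterGroup}
    (hg : g ∈ Subgroup.closure (P.gen '' {G | j q ∈ G.carrier})) :
    ∃ k : Q.coxeterGroup, k • q = q ∧
      (Submodule.Quotient.mk (col.hom (h.groupHom k)).toAdd :
        V ⧸ Submodule.span (ZMod 2) {col.colour F}) =
        Submodule.Quotient.mk (col.hom g).toAdd := by
  induction hg using Subgroup.closure_induction with
  | mem g hg =>
    obtain ⟨G, hG, rfl⟩ := hg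
    by_cases hGF : G = F
    · subst hGF
      refine ⟨1, one_smul _ _, ?_⟩
      rw [map_one, map_one, toAdd_one, col.hom_gen, toAdd_ofAdd, Submodule.Quotient.mk_zero,
        eq_comm, Submodule.Quotient.mk_eq_zero]
      exact Submodule.mem_span_singleton_self _
    · obtain ⟨E, rfl⟩ := h.exists_facetMap_eq hGF ((h.mem_facet_iff q).1 hq) hG
      refine ⟨Q.gen E, Q.gen_smul_eq_self ((h.mem_facetMap_iff E q).1 hG).2, ?_⟩
      rw [h.groupHom_gen]
  | one => exact ⟨1, one_smul _ _, by rw [map_one]⟩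
  | mul a b _ _ ha hb =>
    obtain ⟨k, hk, hk'⟩ := ha
    obtain ⟨l, hl, hl'⟩ := hb
    refine ⟨k * l, by rw [mul_smul, hl, hk], ?_⟩
    simp only [map_mul, toAdd_mul, Submodule.Quotient.mk_add, hk', hl']
  | inv a _ ha =>
    obtain ⟨k, hk, hk'⟩ := ha
    refine ⟨k⁻¹, by rw [inv_smul_eq_iff, hk], ?_⟩
    simp only [map_inv, toAdd_inv, Submodule.Quotient.mk_neg, hk']

/-- Points of the hyperplane of `F` equivalent under `Γ_λ` are equivalent under `(Γ_F)_μ`. -/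
theorem exists_mem_kernel_smul_eq (h : IsFacetModel F Q j) (hμ : IsInducedColouring col F j μ)
    {x y : HypSpace n} {g : P.coxeterGroup} (hg : g ∈ col.kernel) (hgx : g • j x = j y) :
    ∃ k ∈ μ.kernel, k • x = y := by
  obtain ⟨a, ha⟩ := Q.exists_smul_mem x
  obtain ⟨b, hb⟩ := Q.exists_smul_mem y
  -- Once both points are moved into `F`, strictness of the fundamental domain makes them equal, and
  -- the element between them lies in the stabilizer.
  have h1 : (h.groupHom b * g * (h.groupHom a)⁻¹) • j (a • x) = j (b • y) := by
    rw [h.apply_smul, h.apply_smul, mul_smul, mul_smul, inv_smul_smul, hgx]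
  have haP := (h.mem_iff _).1 ha
  have hbP := (h.mem_iff _).1 hb
  obtain ⟨h2, h3⟩ := P.smul_eq_and_mem_closure haP _ (h1 ▸ hbP)
  have h4 : a • x = b • y := h.1.injective (h2.symm.trans h1)
  obtain ⟨k, hk, hk'⟩ := h.exists_smul_eq_of_mem_closure (col := col) ha h3
  -- Modulo the colour of `F`, the element `k` has the colour of the stabilizing element, so the
  -- conjugation leaves the trivial colour of `g`.
  refine ⟨b⁻¹ * k * a, MonoidHom.mem_ker.2 (toAdd_eq_zero.1 ?_), ?_⟩
  · simp only [map_mul, map_inv, toAdd_mul, toAdd_inv, h.hom_eq_mk hμ, hk',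
      MonoidHom.mem_ker.1 hg, toAdd_one, Submodule.Quotient.mk_add, Submodule.Quotient.mk_neg,
      Submodule.Quotient.mk_zero]
    abel
  · rw [mul_smul, mul_smul, hk, h4, inv_smul_smul]

/-- Near a point of the hyperplane of `F`, its translates by `Γ_λ` are translates by
`(Γ_F)_μ`. -/
theorem exists_ball_mem_kernel (h : IsFacetModel F Q j) (hμ : IsInducedColouring col F j μ)
    (x : HypSpace n) : ∃ r > 0, ∀ g ∈ col.kernel, ∀ y, dist (j x) (g • j y) < r →
      ∃ k ∈ μ.kernel, j (k • y) = g • j y := by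
  have hF : IsCompact F.carrier := P.isCompact.inter_right
    (isClosed_eq (HypSpace.continuous_lorentz _) continuous_const)
  obtain ⟨r, hr, hball⟩ := P.exists_ball_mem_smul hF (j x)
  refine ⟨r, hr, fun g hg y hy => ?_⟩
  obtain ⟨b, hb⟩ := Q.exists_smul_mem y
  -- A translate of the compact facet `F` that comes close to `j x` passes through `j x`.
  obtain ⟨z, hz, hzx⟩ := hball (g * (h.groupHom b)⁻¹) (j (b • y)) ((h.mem_facet_iff _).1 hb)
    (by rwa [h.apply_smul, mul_smul, inv_smul_smul])
  obtain ⟨q, rfl⟩ := h.isHyperplaneModel.exists_apply_eq hz.2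
  have h1 : g • j (b⁻¹ • q) = j x := by rw [h.apply_smul, map_inv, ← mul_smul, hzx]
  obtain ⟨k, hk, hkx⟩ := h.exists_mem_kernel_smul_eq hμ hg h1
  obtain ⟨l, hl, hlk⟩ := h.exists_mem_kernel hμ hk
  -- `l` and `g` agree at one point of the hyperplane, so freeness makes them equal.
  have h2 : l⁻¹ * g = 1 := by
    refine col.eq_one_of_smul_eq (mul_mem (inv_mem hl) hg) (x := j (b⁻¹ • q)) ?_
    rw [mul_smul, inv_smul_eq_iff, ← hlk, hkx, h1]
  refine ⟨k, hk, ?_⟩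
  rw [hlk, ← inv_mul_eq_one.1 h2]

end InducedColouring

end IsFacetModel

/-! ### The totally geodesic embedding -/

namespace IsFacetModel

open Topology Filter

variable {n : ℕ} {P : RightAngledPolytope (n + 1)} {F : Facet P.carrier}
  {Q : RightAngledPolytope n} {j : HypSpace n → HypSpace (n + 1)}
  {V : Type*} [AddCommGroup V] [Module (ZMod 2) V] {col : Colouring P V}
  {μ : Colouring Q (V ⧸ Submodule.span (ZMod 2) {col.colour F})}

/-- The map `M_μ → M_λ` induced by the inclusion of the hyperplane of `F`. -/
noncomputable def inclusion (_ : IsFacetModel F Q j) (_ : IsInducedColouring col F j μ)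
    (q : μ.Mfd) : col.Mfd :=
  col.proj (j (Function.surjInv μ.proj_surjective q))

theorem inclusion_proj (h : IsFacetModel F Q j) (hμ : IsInducedColouring col F j μ)
    (x : HypSpace n) : h.inclusion hμ (μ.proj x) = col.proj (j x) := by
  obtain ⟨g, hg, hgx⟩ := (μ.proj_eq_iff _ _).1
    (Function.surjInv_eq μ.proj_surjective (μ.proj x))
  obtain ⟨k, hk, hkx⟩ := h.exists_mem_kernel hμ hg
  rw [inclusion, ← hgx, hkx, col.proj_smul hk]

theorem inclusion_injective (h : IsFacetModel F Q j) (hμ : IsInducedColouring col F j μ) :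
    Function.Injective (h.inclusion hμ) := by
  intro p q hpq
  obtain ⟨x, rfl⟩ := μ.proj_surjective p
  obtain ⟨y, rfl⟩ := μ.proj_surjective q
  rw [h.inclusion_proj, h.inclusion_proj, col.proj_eq_iff] at hpq
  obtain ⟨g, hg, hgy⟩ := hpq
  exact (μ.proj_eq_iff x y).2 (h.exists_mem_kernel_smul_eq hμ hg hgy)

theorem dist_inclusion_le (h : IsFacetModel F Q j) (hμ : IsInducedColouring col F j μ)
    (p q : μ.Mfd) : dist (h.inclusion hμ p) (h.inclusion hμ q) ≤ dist p q := by
  obtain ⟨x, rfl⟩ := μ.proj_surjective p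
  obtain ⟨y, rfl⟩ := μ.proj_surjective q
  refine le_of_forall_gt fun r hr => ?_
  obtain ⟨g, hg, hgy⟩ := (μ.dist_proj_lt_iff x y r).1 hr
  rw [← μ.proj_smul hg y, h.inclusion_proj, h.inclusion_proj]
  refine (col.dist_proj_le _ _).trans_lt ?_
  rwa [h.1.dist_eq]

/-- Near `j x`, the space `M_λ` is isometric to a ball in which the image of `M_μ` is the
hyperplane of `F`. -/
theorem exists_radius (h : IsFacetModel F Q j) (hμ : IsInducedColouring col F j μ)
    (x : HypSpace n) : ∃ r > 0,
      (∀ y ∈ Metric.ball x r, ∀ z ∈ Metric.ball x r, dist (μ.proj y) (μ.proj z) = dist y z) ∧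
      (∀ y ∈ Metric.ball (j x) r, ∀ z ∈ Metric.ball (j x) r,
        dist (col.proj y) (col.proj z) = dist y z) ∧
      ∀ s ≤ r, ∀ q : μ.Mfd, dist (h.inclusion hμ q) (col.proj (j x)) < s →
        ∃ y ∈ Metric.ball x s, μ.proj y = q := by
  obtain ⟨r₁, hr₁, hball₁⟩ := μ.exists_dist_proj_eq x
  obtain ⟨r₂, hr₂, hball₂⟩ := col.exists_dist_proj_eq (j x)
  obtain ⟨r₃, hr₃, hball₃⟩ := h.exists_ball_mem_kernel hμ x
  refine ⟨min r₁ (min r₂ r₃), lt_min hr₁ (lt_min hr₂ hr₃), hball₁ _ (min_le_left _ _),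
    hball₂ _ ((min_le_right _ _).trans (min_le_left _ _)), fun s hs q hq => ?_⟩
  obtain ⟨y, rfl⟩ := μ.proj_surjective q
  rw [h.inclusion_proj, dist_comm, col.dist_proj_lt_iff] at hq
  obtain ⟨g, hg, hgy⟩ := hq
  obtain ⟨k, hk, hky⟩ := hball₃ g hg y
    (hgy.trans_le (hs.trans ((min_le_right _ _).trans (min_le_right _ _))))
  refine ⟨k • y, ?_, μ.proj_smul hk y⟩
  rwa [Metric.mem_ball, dist_comm, ← h.1.dist_eq, hky]

theorem exists_ball_dist_inclusion (h : IsFacetModel F Q j) (hμ : IsInducedColouring col F j μ)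
    (p : μ.Mfd) : ∃ r > 0, ∀ a ∈ Metric.ball p r, ∀ b ∈ Metric.ball p r,
      dist (h.inclusion hμ a) (h.inclusion hμ b) = dist a b := by
  obtain ⟨x, rfl⟩ := μ.proj_surjective p
  obtain ⟨r, hr, hr₁, hr₂, -⟩ := h.exists_radius hμ x
  refine ⟨r, hr, fun a ha b hb => ?_⟩
  rw [← μ.image_proj_ball] at ha hb
  obtain ⟨y, hy, rfl⟩ := ha
  obtain ⟨z, hz, rfl⟩ := hb
  rw [h.inclusion_proj, h.inclusion_proj, hr₁ y hy z hz, hr₂, h.1.dist_eq]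
  · rwa [Metric.mem_ball, h.1.dist_eq]
  · rwa [Metric.mem_ball, h.1.dist_eq]

/-- The last clause of `exists_radius` shows that distant parts of `M_μ` do not return near an image
point, so the inverse on the image is continuous. -/
theorem isEmbedding_inclusion (h : IsFacetModel F Q j) (hμ : IsInducedColouring col F j μ) :
    IsEmbedding (h.inclusion hμ) := by
  have hcont : Continuous (h.inclusion hμ) :=
    (LipschitzWith.of_dist_le_mul (K := 1) fun p q => by
      simpa using h.dist_inclusion_le hμ p q).continuous
  refine ⟨isInducing_iff_nhds.2 fun p => le_antisymm
    (map_le_iff_le_comap.1 (hcont.tendsto p)) ?_, h.inclusion_injective hμ⟩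
  obtain ⟨x, rfl⟩ := μ.proj_surjective p
  obtain ⟨r, hr, -, -, hr₃⟩ := h.exists_radius hμ x
  rw [Metric.nhds_basis_ball.ge_iff]
  intro ε hε
  refine mem_comap.2 ⟨Metric.ball _ (min r ε), Metric.ball_mem_nhds _ (lt_min hr hε), ?_⟩
  intro q hq
  rw [Set.mem_preimage, Metric.mem_ball, h.inclusion_proj] at hq
  obtain ⟨y, hy, rfl⟩ := hr₃ _ (min_le_left _ _) q hq
  exact (μ.dist_proj_le y x).trans_lt (lt_of_lt_of_le hy (min_le_right _ _))

theorem isTotallyGeodesicEmbedding_inclusion (h : IsFacetModel F Q j)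
    (hμ : IsInducedColouring col F j μ) :
    IsTotallyGeodesicEmbedding n (n + 1) (h.inclusion hμ) := by
  refine ⟨h.isEmbedding_inclusion hμ, fun p => ?_, fun γ I _ hγ => ?_⟩
  · obtain ⟨x, rfl⟩ := μ.proj_surjective p
    obtain ⟨r, hr, hr₁, hr₂, hr₃⟩ := h.exists_radius hμ x
    let φ := OpenPartialHomeomorph.ofIsometryOnBall μ.proj x r hr₁ (μ.image_proj_ball x r)
    let ψ := OpenPartialHomeomorph.ofIsometryOnBall col.proj (j x) r hr₂
      (col.image_proj_ball (j x) r)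
    have hφ : ∀ y ∈ Metric.ball x r, φ (μ.proj y) = y := fun y hy =>
      OpenPartialHomeomorph.ofIsometryOnBall_apply hr₁ (μ.image_proj_ball x r) hy
    have hψ : ∀ y ∈ Metric.ball x r, ψ (col.proj (j y)) = j y := fun y hy =>
      OpenPartialHomeomorph.ofIsometryOnBall_apply hr₂ (col.image_proj_ball (j x) r)
        (by rwa [Metric.mem_ball, h.1.dist_eq])
    have hmem : ∀ q, h.inclusion hμ q ∈ ψ.source → ∃ y ∈ Metric.ball x r, μ.proj y = q :=
      fun q hq => hr₃ r le_rfl q hq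
    refine ⟨φ, ψ, j,
      fun p hp q hq => OpenPartialHomeomorph.ofIsometryOnBall_dist hr₁ _ hp hq,
      fun p hp q hq => OpenPartialHomeomorph.ofIsometryOnBall_dist hr₂ _ hp hq,
      h.1, Metric.mem_ball_self hr, ?_, fun q hq => ?_, ?_⟩
    · ext q
      constructor
      · intro hq
        have h1 : dist q (μ.proj x) < r := hq
        have h2 := h.dist_inclusion_le hμ q (μ.proj x)
        rw [h.inclusion_proj] at h2
        exact h2.trans_lt h1
      · intro hq
        obtain ⟨y, hy, rfl⟩ := hmem q hq
        exact (μ.dist_proj_le y x).trans_lt hy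
    · have h1 : q ∈ Metric.ball (μ.proj x) r := hq
      rw [← μ.image_proj_ball] at h1
      obtain ⟨y, hy, rfl⟩ := h1
      rw [h.inclusion_proj, hψ y hy, hφ y hy]
    · ext z
      constructor
      · rintro ⟨_, ⟨hq, q, rfl⟩, rfl⟩
        obtain ⟨y, hy, rfl⟩ := hmem q hq
        refine ⟨ψ.map_source hq, y, ?_⟩
        rw [h.inclusion_proj, hψ y hy]
      · rintro ⟨hz, y, rfl⟩
        have h1 : j y ∈ Metric.ball (j x) r := hz
        rw [Metric.mem_ball, h.1.dist_eq] at h1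
        exact ⟨col.proj (j y), ⟨ψ.map_target hz, μ.proj y, h.inclusion_proj hμ y⟩, hψ y h1⟩
  · obtain ⟨c, hc, hγ⟩ := hγ
    refine ⟨c, hc, fun t ht => ?_⟩
    obtain ⟨ε, hε, hdist⟩ := hγ t ht
    obtain ⟨r, hr, hball⟩ := h.exists_ball_dist_inclusion hμ (γ t)
    -- At speed `c` the geodesic stays for this time in a ball where the inclusion preserves
    -- distances; `c + 1` allows for constant geodesics.
    have hδ : 0 < r / (c + 1) := div_pos hr (by linarith)
    refine ⟨min ε (r / (c + 1)), lt_min hε hδ, fun s hs s' hs' hst hst' => ?_⟩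
    have hmem : ∀ u ∈ I, |u - t| < min ε (r / (c + 1)) → γ u ∈ Metric.ball (γ t) r := by
      intro u hu hut
      rw [Metric.mem_ball, hdist u hu t ht (hut.trans_le (min_le_left _ _)) (by simpa using hε)]
      have h1 := hut.trans_le (min_le_right _ _)
      rw [lt_div_iff₀ (by linarith)] at h1
      nlinarith [abs_nonneg (u - t)]
    rw [← hdist s hs s' hs' (hst.trans_le (min_le_left _ _)) (hst'.trans_le (min_le_left _ _))]
    exact hball _ (hmem s hs hst) _ (hmem s' hs' hst')

/-- By equivariance of `j` the right side lies in `P` and in the orbit of `j x`; this is the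
compatibility of the two covers. -/
theorem fold_apply (h : IsFacetModel F Q j) (x : HypSpace n) : P.fold (j x) = j (Q.fold x) := by
  refine P.fold_eq ((h.mem_iff _).1 (Q.fold_mem x)) ?_
  obtain ⟨g, hg⟩ := Q.fold_mem_orbit x
  exact ⟨h.groupHom g, by rw [← hg]; exact (h.apply_smul g x).symm⟩

end IsFacetModel

theorem mainTheorem6 {n : ℕ} (hn : 1 ≤ n) (P : RightAngledPolytope (n + 1))
    {V : Type*} [AddCommGroup V] [Module (ZMod 2) V] [FiniteDimensional (ZMod 2) V]
    (col : Colouring P V) (F : Facet P.carrier) :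
    -- the facet `F` is a right-angled polytope in a hyperbolic space of one dimension less
    (∃ (Q : RightAngledPolytope n) (j : HypSpace n → HypSpace (n + 1)), IsFacetModel F Q j) ∧
    ∀ (Q : RightAngledPolytope n) (j : HypSpace n → HypSpace (n + 1)), IsFacetModel F Q j →
      -- the induced colouring exists and is unique
      (∃! μ : Colouring Q (V ⧸ Submodule.span (ZMod 2) {col.colour F}),
        IsInducedColouring col F j μ) ∧
      ∀ μ : Colouring Q (V ⧸ Submodule.span (ZMod 2) {col.colour F}),
        IsInducedColouring col F j μ →
        -- `M_λ` and `M_μ` are hyperbolic manifolds, with well-defined covers of `P` and `F`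
        IsHyperbolicManifold (n + 1) col.Mfd ∧ IsHyperbolicManifold n μ.Mfd ∧
        (∃! c : col.Mfd → P.carrier, col.IsCover c) ∧
        (∃! c' : μ.Mfd → Q.carrier, μ.IsCover c') ∧
        -- the inclusion of the hyperplane of `F` induces a totally geodesic embedding of `M_μ`
        -- in `M_λ`, along which the cover of `P` restricts to the cover of `F`
        ∃ ι : μ.Mfd → col.Mfd, IsTotallyGeodesicEmbedding n (n + 1) ι ∧
          (∀ x : HypSpace n, ι (μ.proj x) = col.proj (j x)) ∧
          ∀ (c : col.Mfd → P.carrier) (c' : μ.Mfd → Q.carrier), col.IsCover c → μ.IsCover c' →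
            Continuous c ∧ Continuous c' ∧
            ∀ p : μ.Mfd, (c (ι p) : HypSpace (n + 1)) = j (c' p) := by

  constructor
  · obtain ⟨j, hj⟩ := F.normal.exists_isHyperplaneModel
    obtain ⟨Q, hQ⟩ := hj.exists_isFacetModel
    exact ⟨Q, j, hQ⟩
  · intro Q j h
    refine ⟨h.existsUnique_isInducedColouring col, fun μ hμ => ⟨col.isHyperbolicManifold,
      μ.isHyperbolicManifold, col.existsUnique_isCover, μ.existsUnique_isCover, h.inclusion hμ,
      h.isTotallyGeodesicEmbedding_inclusion hμ, h.inclusion_proj hμ,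
      fun c c' hc hc' => ⟨hc.continuous, hc'.continuous, fun p => ?_⟩⟩⟩
    obtain ⟨x, rfl⟩ := μ.proj_surjective p
    rw [h.inclusion_proj, hc.apply_proj, hc'.apply_proj, h.fold_apply]
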